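/- Let $d\ge 2$, let $T$ be the $d$-regular rooted tree, whose vertices are the finite words over $\{1,\dots,d\}$ (level $n$, denoted $\mathcal L_n$, consists of the words of length $n$), and let $G\le \operatorname{Aut}(T)$. For $g\in\operatorname{Aut}(T)$ and a vertex $v$, the section $\varphi_v(g)\in\operatorname{Aut}(T)$ is defined by $g(vw)=g(v)\,\varphi_v(g)(w)$ for all words $w$; $\operatorname{Stab}_G(V)$ denotes the pointwise stabilizer of a set $V$ of vertices. Assume the following. 1. $G$ is finitely generated. 2. $G$ is strongly self-replicating: $\varphi_v(\operatorname{Stab}_G(v))\le G$ for every vertex $v$ (i.e. $G$ is self-similar), and $\varphi_v(\operatorname{Stab}_G(\mathcal L_n))=G$ for every $n$ and every $v\in\mathcal L_n$. 3. $G$ is regular branch: it is self-similar, acts transitively on every level, and has a finite index subgroup $K$ containing every $g\in\operatorname{Aut}(T)$ that fixes $\mathcal L_1$ pointwise and satisfies $\varphi_v(g)\in K$ for all $v\in\mathcal L_1$ (that is, $K$ geometrically contains $K\times\dots\times K$, with $d$ factors). 4. $\operatorname{Stab}_G(v)=\operatorname{Stab}_G(\mathcal L_1)$ for every $v\in\mathcal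 L_1$. 5. $G$ has the congruence subgroup property: every finite index subgroup of $G$ contains $\operatorname{Stab}_G(\mathcal L_n)$ for some $n$. 6. $G$ has the subgroup induction property: every finitely generated subgroup of $G$ belongs to every inductive class. Here a class $\mathcal X$ of subgroups of $G$ is inductive if (A) $\{1\}\in\mathcal X$ and $G\in\mathcal X$; (B) whenever $H\le L\le G$ and $[L:H]<\infty$, one has $L\in\mathcal X$ if and only if $H\in\mathcal X$; (C) every finitely generated $H\le\operatorname{Stab}_G(\mathcal L_1)$ with $\varphi_v(H)\in\mathcal X$ for all $v\in\mathcal L_1$ belongs to $\mathcal X$. Then the space $\operatorname{Sub}(G)$ of subgroups of $G$, with the topology induced from the product topology on $\{0,1\}^G$, has Cantor–Bendixson rank $\omega$. That is, $\omega$ is the least ordinal $\alpha$ with $\operatorname{Sub}(G)^{(\alpha)}=\operatorname{Sub}(G)^{(\alpha+1)}$, where $X^{(0)}=X$, $X^{(\alpha+1)}$ is the set of non-isolated points of $X^{(\alpha)}$, and $X^{(\lambda)}=\bigcap_{\alpha<\lambda}X^{(\alpha)}$ for limit ordinals $\lambda$. -/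

import Mathlib

namespace RootedTree

/-- The group `Aut(T)` of automorphisms of the `d`-regular rooted tree `T`. The vertices are the
finite words over `{0, …, d-1}`, the root is the empty word and `v ≤ w` means that `v` is a prefix
of `w`; automorphisms are the bijections preserving this order (hence also the levels). -/
abbrev TreeAut (d : ℕ) : Type :=
  ((· <+: ·) : List (Fin d) → List (Fin d) → Prop) ≃r
    ((· <+: ·) : List (Fin d) → List (Fin d) → Prop)

/-- The `n`-th level of the tree. -/
def level (d n : ℕ) : Set (List (Fin d)) := {v | v.length = n}

theorem length_le {d : ℕ} (g : TreeAut d) (v : List (Fin d)) : v.length ≤ (g v).length := by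
  induction v using List.reverseRecOn with
  | nil => simp
  | append_singleton v x ih =>
    have h1 : g v <+: g (v ++ [x]) := g.map_rel_iff.2 (List.prefix_append v [x])
    have h2 : (g v).length ≠ (g (v ++ [x])).length := fun h => by
      have h3 := g.injective (h1.eq_of_length h)
      simp at h3
    have h4 := h1.length_le
    simp only [List.length_append, List.length_singleton]
    omega

theorem length_apply {d : ℕ} (g : TreeAut d) (v : List (Fin d)) : (g v).length = v.length := by
  have h := length_le g.symm (g v)
  rw [RelIso.symm_apply_apply] at h
  exact le_antisymm h (length_le g v)

theorem apply_append {d : ℕ} (g : TreeAut d) (v w : List (Fin d)) :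
    g (v ++ w) = g v ++ (g (v ++ w)).drop v.length := by
  have h : g v <+: g (v ++ w) := g.map_rel_iff.2 (List.prefix_append v w)
  obtain ⟨u, hu⟩ := h
  rw [← hu, ← length_apply g v, List.drop_left]

/-- The section `φ_v(g)` of the automorphism `g` at the vertex `v`: the automorphism determined by
`g (v w) = (g v) (φ_v(g) w)`, see `apply_append_sec`. -/
def sec {d : ℕ} (v : List (Fin d)) (g : TreeAut d) : TreeAut d where
  toFun w := (g (v ++ w)).drop v.length
  invFun w := (g.symm (g v ++ w)).drop v.length
  left_inv w := by
    simp only [← apply_append, RelIso.symm_apply_apply, List.drop_left]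
  right_inv w := by
    have h := apply_append g.symm (g v) w
    rw [RelIso.symm_apply_apply, length_apply] at h
    simp only [← h, RelIso.apply_symm_apply]
    rw [← length_apply g v, List.drop_left]
  map_rel_iff' {a b} := by
    have h : g (v ++ a) <+: g (v ++ b) ↔ v ++ a <+: v ++ b := g.map_rel_iff
    rw [apply_append g v a, apply_append g v b, List.prefix_append_right_inj,
      List.prefix_append_right_inj] at h
    exact h

theorem apply_append_sec {d : ℕ} (g : TreeAut d) (v w : List (Fin d)) :
    g (v ++ w) = g v ++ sec v g w :=
  apply_append g v w

theorem sec_eq_iff {d : ℕ} {g h : TreeAut d} {v : List (Fin d)} :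
    sec v g = h ↔ ∀ w, g (v ++ w) = g v ++ h w := by
  constructor
  · rintro rfl w
    exact apply_append_sec g v w
  · intro H
    ext1 w
    exact List.append_cancel_left ((apply_append_sec g v w).symm.trans (H w))

/-- The pointwise stabilizer `Stab_G(V)` of a set `V` of vertices. -/
def stab {d : ℕ} (G : Subgroup (TreeAut d)) (V : Set (List (Fin d))) : Subgroup (TreeAut d) where
  carrier := {g | g ∈ G ∧ ∀ v ∈ V, g v = v}
  one_mem' := ⟨G.one_mem, fun _ _ => rfl⟩
  mul_mem' {a b} ha hb := ⟨G.mul_mem ha.1 hb.1, fun v hv => by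
    rw [RelIso.mul_apply, hb.2 v hv, ha.2 v hv]⟩
  inv_mem' {a} ha := ⟨G.inv_mem ha.1, fun v hv => by
    conv_lhs => rw [← ha.2 v hv]
    exact a.symm_apply_apply v⟩

/-- The section `φ_v(Stab_H(v))` of the subgroup `H` at the vertex `v`. -/
def secSubgroup {d : ℕ} (v : List (Fin d)) (H : Subgroup (TreeAut d)) :
    Subgroup (TreeAut d) where
  carrier := {h | ∃ g ∈ stab H {v}, sec v g = h}
  one_mem' := ⟨1, one_mem _, sec_eq_iff.2 fun _ => rfl⟩
  mul_mem' := by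
    rintro _ _ ⟨a, ha, rfl⟩ ⟨b, hb, rfl⟩
    have hb' : b v = v := hb.2 v rfl
    refine ⟨a * b, mul_mem ha hb, sec_eq_iff.2 fun w => ?_⟩
    simp only [RelIso.mul_apply]
    rw [apply_append_sec b v w, hb', apply_append_sec a v]
  inv_mem' := by
    rintro _ ⟨a, ha, rfl⟩
    have ha' : a v = v := ha.2 v rfl
    have hi : a⁻¹ v = v := (inv_mem ha).2 v rfl
    refine ⟨a⁻¹, inv_mem ha, sec_eq_iff.2 fun w => a.injective ?_⟩
    rw [hi, apply_append_sec a v, ha']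
    exact (a.apply_symm_apply _).trans
      (congrArg (v ++ ·) ((sec v a).apply_symm_apply w).symm)

/-- `G` is self-similar: `φ_v(Stab_G(v)) ≤ G` for every vertex `v`. -/
def IsSelfSimilar {d : ℕ} (G : Subgroup (TreeAut d)) : Prop :=
  ∀ v : List (Fin d), secSubgroup v G ≤ G

/-- `G` is strongly self-replicating: it is self-similar and `φ_v(Stab_G(level n)) = G` for every
`n` and every vertex `v` of level `n`. -/
def IsStronglySelfReplicating {d : ℕ} (G : Subgroup (TreeAut d)) : Prop :=
  IsSelfSimilar G ∧ ∀ n : ℕ, ∀ v ∈ level d n, secSubgroup v (stab G (level d n)) = G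

/-- `G` acts transitively on each level of the tree. -/
def IsLevelTransitive {d : ℕ} (G : Subgroup (TreeAut d)) : Prop :=
  ∀ n : ℕ, ∀ v ∈ level d n, ∀ w ∈ level d n, ∃ g ∈ G, g v = w

/-- `G` is a regular branch group: it is self-similar, transitive on the levels, and has a
subgroup `K` of finite index which geometrically contains `K × ⋯ × K` (`d` factors), that is, every
element of `Stab(level 1)` all of whose first-level sections lie in `K` belongs to `K`. -/
def IsRegularBranch {d : ℕ} (G : Subgroup (TreeAut d)) : Prop :=
  IsSelfSimilar G ∧ IsLevelTransitive G ∧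
    ∃ K : Subgroup (TreeAut d), K ≤ G ∧ K.relIndex G ≠ 0 ∧
      ∀ g ∈ stab ⊤ (level d 1), (∀ x : Fin d, sec [x] g ∈ K) → g ∈ K

/-- The congruence subgroup property: every subgroup of finite index of `G` contains
`Stab_G(level n)` for some `n`. -/
def HasCongruenceSubgroupProperty {d : ℕ} (G : Subgroup (TreeAut d)) : Prop :=
  ∀ H : Subgroup (TreeAut d), H ≤ G → H.relIndex G ≠ 0 → ∃ n : ℕ, stab G (level d n) ≤ H

/-- Inductive classes of subgroups of a self-similar group `G`. -/
structure IsInductiveClass {d : ℕ} (G : Subgroup (TreeAut d))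
    (𝒳 : Set (Subgroup (TreeAut d))) : Prop where
  le_of_mem : ∀ H ∈ 𝒳, H ≤ G
  bot_mem : ⊥ ∈ 𝒳
  self_mem : G ∈ 𝒳
  mem_iff_of_finite_index : ∀ H L : Subgroup (TreeAut d), H ≤ L → L ≤ G → H.relIndex L ≠ 0 →
    (L ∈ 𝒳 ↔ H ∈ 𝒳)
  mem_of_sections : ∀ H : Subgroup (TreeAut d), H.FG → H ≤ stab G (level d 1) →
    (∀ x : Fin d, secSubgroup [x] H ∈ 𝒳) → H ∈ 𝒳

/-- The subgroup induction property (of a self-similar group `G`): every inductive class contains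
all finitely generated subgroups of `G`. -/
def HasSubgroupInductionProperty {d : ℕ} (G : Subgroup (TreeAut d)) : Prop :=
  ∀ 𝒳 : Set (Subgroup (TreeAut d)), IsInductiveClass G 𝒳 →
    ∀ H : Subgroup (TreeAut d), H ≤ G → H.FG → H ∈ 𝒳

end RootedTree

/-- The space of subgroups `Sub(Γ)` of a discrete group `Γ`: the subspace topology from
`{0, 1}^Γ`, each subgroup being identified with its indicator function. -/
noncomputable instance subgroupSpace {Γ : Type*} [Group Γ] : TopologicalSpace (Subgroup Γ) :=
  open Classical in
  TopologicalSpace.induced (fun (H : Subgroup Γ) (g : Γ) => decide (g ∈ H))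
    (inferInstance : TopologicalSpace (Γ → Bool))

/-- The Cantor–Bendixson rank of a topological space `X`: the least ordinal `α` with
`X^(α) = X^(α+1)`, where `X^(α)` is the `α`-th iterated derived set of `X`. -/
noncomputable def cantorBendixsonRank (X : Type*) [TopologicalSpace X] : Ordinal :=
  sInf {α | CantorBendixson.iteratedDerivedSet (Set.univ : Set X) (α + 1) =
    CantorBendixson.iteratedDerivedSet (Set.univ : Set X) α}

namespace RootedTree

variable {d : ℕ}

/-! ### Sections and level stabilizers -/

/-! Call a subgroup full if, on some level, all its sections have finite index in `G`. The non-full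
subgroups form the perfect kernel, while full subgroups have finite but unbounded rank; hence the
rank of the space is `ω`.

Non-full subgroups accumulate on one another (`preperfect_not_isFull`). Full subgroups are finitely
generated (`fg_of_isFull`) and fullness passes to overgroups in `G`, so a subgroup that is not
finitely generated is a limit of finitely generated, non-full subgroups of itself. A finitely
generated non-full subgroup has a finite section at some vertex, by subgroup induction. Adjoining
ever deeper elements supported below a suitable orbit of vertices then gives distinct subgroups
converging to it, which keep a finite section off that orbit (`exists_ne_of_finite`).

For a full subgroup `L`, fix suitable levels `n ≤ N`. A section at a vertex of level `N` may or may
not be forced to be trivial by triviality at a vertex `v` of level `n`. Commutators produce elements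
of `L` that are trivial at all vertices not determined by `v` and whose sections at `v` fill a deep
level stabilizer (`exists_le_secSubgroup_freePart`). So an overgroup with the same determined
vertices has no new elements deep down (`exists_inf_levelStab_le`). A subgroup close to `L` contains
`L`; if it loses no determined vertex, it normalizes a subgroup of finite index in `L` and must
equal `L`. Thus the finite number `linkCount` bounds the rank. Conversely, in `linked` subgroups `r`
equalities between sections can be relaxed one at a time to agreement up to finite depth, which
gives rank at least `r`.

The engine is `exists_le_of_normal`: a nontrivial subgroup normalized by `G` contains a level
stabilizer of `G`. -/

theorem apply_nil (g : TreeAut d) : g [] = [] :=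
  List.eq_nil_of_length_eq_zero (by simp [length_apply])

theorem sec_mul (g h : TreeAut d) (v : List (Fin d)) :
    sec v (g * h) = sec (h v) g * sec v h := by
  refine sec_eq_iff.2 fun w => ?_
  simp only [RelIso.mul_apply]
  rw [apply_append_sec h, apply_append_sec g]

theorem sec_one (v : List (Fin d)) : sec v (1 : TreeAut d) = 1 :=
  sec_eq_iff.2 fun _ => rfl

theorem sec_nil (g : TreeAut d) : sec [] g = g :=
  sec_eq_iff.2 fun w => by simp [apply_nil]

theorem sec_append (g : TreeAut d) (v w : List (Fin d)) :
    sec (v ++ w) g = sec w (sec v g) := by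
  refine sec_eq_iff.2 fun u => ?_
  rw [List.append_assoc, apply_append_sec g v, apply_append_sec _ w, apply_append_sec g v w,
    List.append_assoc]

theorem inv_apply_of_fixed {g : TreeAut d} {v : List (Fin d)} (h : g v = v) : g⁻¹ v = v := by
  conv_lhs => rw [← h]
  exact g.symm_apply_apply v

theorem inv_apply_apply (g : TreeAut d) (v : List (Fin d)) : g⁻¹ (g v) = v :=
  g.symm_apply_apply v

theorem apply_inv_apply (g : TreeAut d) (v : List (Fin d)) : g (g⁻¹ v) = v :=
  g.apply_symm_apply v

theorem sec_inv (g : TreeAut d) (v : List (Fin d)) : sec (g v) g⁻¹ = (sec v g)⁻¹ := by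
  have h := sec_mul g⁻¹ g v
  rw [inv_mul_cancel, sec_one] at h
  exact (inv_eq_of_mul_eq_one_left h.symm).symm

theorem sec_inv_of_fixed {g : TreeAut d} {v : List (Fin d)} (h : g v = v) :
    sec v g⁻¹ = (sec v g)⁻¹ := by
  simpa [h] using sec_inv g v

theorem sec_mul_of_fixed (g : TreeAut d) {h : TreeAut d} {v : List (Fin d)} (hv : h v = v) :
    sec v (g * h) = sec v g * sec v h := by
  rw [sec_mul, hv]

theorem mem_secSubgroup {v : List (Fin d)} {H : Subgroup (TreeAut d)} {h : TreeAut d} :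
    h ∈ secSubgroup v H ↔ ∃ g ∈ H, g v = v ∧ sec v g = h := by
  constructor
  · rintro ⟨g, hg, rfl⟩
    exact ⟨g, hg.1, hg.2 v rfl, rfl⟩
  · rintro ⟨g, hg, hv, rfl⟩
    exact ⟨g, ⟨hg, fun w hw => by rw [Set.mem_singleton_iff.1 hw, hv]⟩, rfl⟩

theorem secSubgroup_mono (v : List (Fin d)) {H L : Subgroup (TreeAut d)} (h : H ≤ L) :
    secSubgroup v H ≤ secSubgroup v L := by
  intro x hx
  obtain ⟨g, hg, hv, rfl⟩ := mem_secSubgroup.1 hx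
  exact mem_secSubgroup.2 ⟨g, h hg, hv, rfl⟩

theorem secSubgroup_append (v w : List (Fin d)) (H : Subgroup (TreeAut d)) :
    secSubgroup (v ++ w) H = secSubgroup w (secSubgroup v H) := by
  ext x
  simp only [mem_secSubgroup]
  constructor
  · rintro ⟨g, hg, hv, rfl⟩
    rw [apply_append_sec] at hv
    obtain ⟨h1, h2⟩ := List.append_inj hv (length_apply g v)
    exact ⟨sec v g, ⟨g, hg, h1, rfl⟩, h2, (sec_append g v w).symm⟩
  · rintro ⟨_, ⟨g, hg, h1, rfl⟩, h2, rfl⟩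
    exact ⟨g, hg, by rw [apply_append_sec, h1, h2], sec_append g v w⟩

/-- The pointwise stabilizer in `Aut(T)` of the `n`-th level. -/
def levelStab (d n : ℕ) : Subgroup (TreeAut d) := stab ⊤ (level d n)

theorem mem_levelStab {n : ℕ} {g : TreeAut d} :
    g ∈ levelStab d n ↔ ∀ v : List (Fin d), v.length = n → g v = v :=
  ⟨fun h v hv => h.2 v hv, fun h => ⟨trivial, fun v hv => h v hv⟩⟩

theorem stab_level (G : Subgroup (TreeAut d)) (n : ℕ) :
    stab G (level d n) = G ⊓ levelStab d n := by
  ext g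
  exact ⟨fun h => ⟨h.1, trivial, h.2⟩, fun h => ⟨h.1, h.2.2⟩⟩

instance levelStab_normal (n : ℕ) : (levelStab d n).Normal where
  conj_mem h hh g := by
    rw [mem_levelStab] at hh ⊢
    intro v hv
    simp only [RelIso.mul_apply]
    rw [hh _ (by rw [length_apply, hv])]
    exact apply_inv_apply g v

theorem levelStab_zero : levelStab d 0 = ⊤ := by
  refine eq_top_iff.2 fun g _ => mem_levelStab.2 fun v hv => ?_
  rw [List.eq_nil_of_length_eq_zero hv, apply_nil]

theorem fixed_of_mem_levelStab [Nonempty (Fin d)] {n : ℕ} {g : TreeAut d}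
    (hg : g ∈ levelStab d n) {v : List (Fin d)} (hv : v.length ≤ n) : g v = v := by
  obtain ⟨x⟩ := ‹Nonempty (Fin d)›
  have h := mem_levelStab.1 hg (v ++ List.replicate (n - v.length) x) (by simp; omega)
  rw [apply_append_sec] at h
  exact (List.append_inj h (length_apply g v)).1

theorem levelStab_antitone [Nonempty (Fin d)] : Antitone (levelStab d) := fun _ _ h _ hg =>
  mem_levelStab.2 fun _ hv => fixed_of_mem_levelStab hg (hv.le.trans h)

theorem mem_levelStab_add [Nonempty (Fin d)] {n k : ℕ} {g : TreeAut d} :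
    g ∈ levelStab d (n + k) ↔
      g ∈ levelStab d n ∧ ∀ v : List (Fin d), v.length = n → sec v g ∈ levelStab d k := by
  constructor
  · refine fun h => ⟨levelStab_antitone (Nat.le_add_right n k) h, fun v hv =>
      mem_levelStab.2 fun w hw => ?_⟩
    have h1 := mem_levelStab.1 h (v ++ w) (by simp [hv, hw])
    rw [apply_append_sec, fixed_of_mem_levelStab h (by omega)] at h1
    exact List.append_cancel_left h1
  · rintro ⟨h1, h2⟩
    refine mem_levelStab.2 fun u hu => ?_
    rw [← List.take_append_drop n u, apply_append_sec,
      mem_levelStab.1 h1 _ (by simp [hu]),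
      mem_levelStab.1 (h2 _ (by simp [hu])) _ (by simp [hu])]

theorem eq_one_of_sec_eq_one {n : ℕ} [Nonempty (Fin d)] {g : TreeAut d} (hg : g ∈ levelStab d n)
    (h : ∀ v : List (Fin d), v.length = n → sec v g = 1) : g = 1 := by
  ext1 w
  rcases le_or_gt w.length n with hw | hw
  · exact fixed_of_mem_levelStab hg hw
  · conv_lhs => rw [← List.take_append_drop n w]
    rw [apply_append_sec, h _ (by simp; omega), mem_levelStab.1 hg _ (by simp; omega)]
    exact List.take_append_drop n w

theorem eq_of_sec_eq {n : ℕ} [Nonempty (Fin d)] {g h : TreeAut d} (hg : g ∈ levelStab d n)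
    (hh : h ∈ levelStab d n)
    (H : ∀ v : List (Fin d), v.length = n → sec v g = sec v h) : g = h := by
  refine inv_mul_eq_one.1 (eq_one_of_sec_eq_one (mul_mem (inv_mem hg) hh) fun v hv => ?_)
  rw [sec_mul_of_fixed _ (mem_levelStab.1 hh v hv), sec_inv_of_fixed (mem_levelStab.1 hg v hv),
    H v hv, inv_mul_cancel]

theorem exists_notMem_levelStab {g : TreeAut d} (hg : g ≠ 1) : ∃ n, g ∉ levelStab d n := by
  by_contra! h
  exact hg (by ext1 v; exact mem_levelStab.1 (h v.length) v rfl)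

theorem finite_level (d n : ℕ) : {v : List (Fin d) | v.length = n}.Finite :=
  List.finite_length_eq (Fin d) n

/-- The action of `Aut(T)` on the `n`-th level. -/
def levelHom (d n : ℕ) : TreeAut d →* Equiv.Perm {v : List (Fin d) // v.length = n} where
  toFun g := Equiv.Perm.subtypePerm g.toEquiv fun v => by
    show (g v).length = n ↔ _
    rw [length_apply]
  map_one' := rfl
  map_mul' _ _ := rfl

theorem levelHom_ker (n : ℕ) : (levelHom d n).ker = levelStab d n := by
  ext g
  rw [MonoidHom.mem_ker, mem_levelStab, Equiv.ext_iff]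
  exact ⟨fun h v hv => congrArg Subtype.val (h ⟨v, hv⟩), fun h v => Subtype.ext (h v v.2)⟩

theorem levelStab_index_ne_zero (d n : ℕ) : (levelStab d n).index ≠ 0 := by
  have : Finite {v : List (Fin d) // v.length = n} := finite_level d n
  rw [← levelHom_ker, Subgroup.index_ker]
  exact Nat.card_pos.ne'

theorem levelStab_relIndex_ne_zero (n : ℕ) (H : Subgroup (TreeAut d)) :
    (levelStab d n).relIndex H ≠ 0 := fun h =>
  levelStab_index_ne_zero d n (Subgroup.index_eq_zero_of_relIndex_eq_zero h)

theorem inf_levelStab_relIndex_ne_zero (n : ℕ) (H : Subgroup (TreeAut d)) :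
    (H ⊓ levelStab d n).relIndex H ≠ 0 := by
  rw [Subgroup.inf_relIndex_left]
  exact levelStab_relIndex_ne_zero n H

/-- Each further level costs one factor `d!`, which kills the permutation that a section induces on
the `d` letters. -/
theorem pow_mem_levelStab [Nonempty (Fin d)] (k : ℕ) (g : TreeAut d) :
    g ^ (d.factorial ^ k) ∈ levelStab d k := by
  induction k with
  | zero => simp [levelStab_zero]
  | succ k ih =>
    set h := g ^ (d.factorial ^ k)
    rw [pow_succ, pow_mul]
    change h ^ d.factorial ∈ _
    refine mem_levelStab_add.2 ⟨pow_mem ih _, fun v hv => ?_⟩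
    have hp : ∀ t : ℕ, sec v (h ^ t) = sec v h ^ t := fun t => by
      induction t with
      | zero => simp [sec_one]
      | succ t iht => rw [pow_succ, pow_succ, sec_mul_of_fixed _ (mem_levelStab.1 ih v hv), iht]
    rw [hp, ← levelHom_ker, MonoidHom.mem_ker, map_pow]
    let e : Fin d ≃ {v : List (Fin d) // v.length = 1} :=
      { toFun := fun x => ⟨[x], rfl⟩
        invFun := fun v => v.1.head (by rintro h; simpa [h] using v.2)
        left_inv := fun x => rfl
        right_inv := fun v => by
          obtain ⟨x, hx⟩ := List.length_eq_one_iff.1 v.2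
          ext1
          simp [hx] }
    have : Finite {v : List (Fin d) // v.length = 1} := finite_level d 1
    have hc : Nat.card (Equiv.Perm {v : List (Fin d) // v.length = 1}) = d.factorial := by
      rw [Nat.card_congr (Equiv.permCongr e).symm, Nat.card_perm]
      simp
    rw [← hc]
    exact pow_card_eq_one'

/-! ### Automorphisms with prescribed sections -/

theorem glue_aux (n : ℕ) (f : List (Fin d) → TreeAut d) {a b : List (Fin d)} (h : a <+: b) :
    a.take n ++ f (a.take n) (a.drop n) <+: b.take n ++ f (b.take n) (b.drop n) := by
  obtain ⟨c, rfl⟩ := h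
  rcases le_or_gt a.length n with ha | ha
  · rw [List.drop_eq_nil_of_le ha, apply_nil, List.append_nil]
    refine List.IsPrefix.trans ?_ (List.prefix_append _ _)
    rw [List.take_append]
    exact List.prefix_append _ _
  · rw [List.take_append_of_le_length ha.le, List.drop_append_of_le_length ha.le,
      List.prefix_append_right_inj]
    exact (f _).map_rel_iff.2 (List.prefix_append _ _)

theorem glue_aux_inv (n : ℕ) (f f' : List (Fin d) → TreeAut d) (hf : ∀ v u, f' v (f v u) = u)
    (w : List (Fin d)) :
    (w.take n ++ f (w.take n) (w.drop n)).take n ++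
      f' ((w.take n ++ f (w.take n) (w.drop n)).take n)
        ((w.take n ++ f (w.take n) (w.drop n)).drop n) = w := by
  rcases le_or_gt w.length n with hw | hw
  · simp [List.drop_eq_nil_of_le hw, apply_nil, List.take_of_length_le hw]
  · have h1 : (w.take n).length = n := by simp; omega
    rw [List.take_left' h1, List.drop_left' h1, hf, List.take_append_drop]

/-- The automorphism which fixes the `n`-th level and has the section `f v` at each vertex `v` of
that level. -/
def glue (n : ℕ) (f : List (Fin d) → TreeAut d) : TreeAut d where
  toFun w := w.take n ++ f (w.take n) (w.drop n)
  invFun w := w.take n ++ (f (w.take n))⁻¹ (w.drop n)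
  left_inv w := glue_aux_inv n f (fun v => (f v)⁻¹) (fun v u => inv_apply_apply _ u) w
  right_inv w := glue_aux_inv n (fun v => (f v)⁻¹) f (fun v u => apply_inv_apply _ u) w
  map_rel_iff' {a b} := by
    refine ⟨fun h => ?_, fun h => glue_aux n f h⟩
    have h1 := glue_aux n (fun v => (f v)⁻¹) h
    simp only [Equiv.coe_fn_mk] at h1
    rwa [glue_aux_inv n f (fun v => (f v)⁻¹) (fun v u => inv_apply_apply _ u),
      glue_aux_inv n f (fun v => (f v)⁻¹) (fun v u => inv_apply_apply _ u)] at h1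

theorem glue_apply (n : ℕ) (f : List (Fin d) → TreeAut d) (w : List (Fin d)) :
    glue n f w = w.take n ++ f (w.take n) (w.drop n) := rfl

theorem glue_mem_levelStab (n : ℕ) (f : List (Fin d) → TreeAut d) : glue n f ∈ levelStab d n :=
  mem_levelStab.2 fun v hv => by
    rw [glue_apply, List.drop_eq_nil_of_le hv.le, apply_nil, List.take_of_length_le hv.le,
      List.append_nil]

theorem sec_glue {n : ℕ} (f : List (Fin d) → TreeAut d) {v : List (Fin d)} (hv : v.length = n) :
    sec v (glue n f) = f v :=
  sec_eq_iff.2 fun w => by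
    rw [mem_levelStab.1 (glue_mem_levelStab n f) v hv, glue_apply, List.take_left' hv,
      List.drop_left' hv]

/-- The automorphism supported below the vertex `v`, where its section is `s`. -/
def delta (v : List (Fin d)) (s : TreeAut d) : TreeAut d :=
  open Classical in glue v.length (fun u => if u = v then s else 1)

theorem delta_mem_levelStab (v : List (Fin d)) (s : TreeAut d) :
    delta v s ∈ levelStab d v.length := glue_mem_levelStab _ _

theorem sec_delta_self (v : List (Fin d)) (s : TreeAut d) : sec v (delta v s) = s := by
  rw [delta, sec_glue _ rfl, if_pos rfl]

theorem sec_delta_of_ne {u v : List (Fin d)} (s : TreeAut d) (h : u.length = v.length)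
    (huv : u ≠ v) : sec u (delta v s) = 1 := by
  rw [delta, sec_glue _ h, if_neg huv]

end RootedTree

/-! ### Finite abelianizations and finitely generated subgroups. -/

/-- A finitely generated group has finite abelianization if, for some prime `p`, every finite
quotient of it has exponent prime to `p`. -/
theorem commutator_finiteIndex_of_exponent_coprime {Γ : Type*} [Group Γ] [Group.FG Γ] {p : ℕ}
    (hp : p.Prime)
    (h : ∀ B : Subgroup Γ, B.FiniteIndex → ∃ e : ℕ, e.Coprime p ∧ ∀ g : Γ, g ^ e ∈ B) :
    (commutator Γ).FiniteIndex := by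
  have hsurj : Function.Surjective (Abelianization.of (G := Γ)) := QuotientGroup.mk_surjective
  have hfg : Group.FG (Abelianization Γ) :=
    Group.fg_of_surjective (f := Abelianization.of) hsurj
  set R : Subgroup (Abelianization Γ) := (powMonoidHom p : Abelianization Γ →* _).range with hR
  have hpow : ∀ a : Abelianization Γ, a ^ p ∈ R := fun a => ⟨a, rfl⟩
  have hRi : R.FiniteIndex := Subgroup.finiteIndex_range_powMonoidHom_of_fg _ hp.ne_zero
  -- The `p`-th powers have finite index, so they contain all `e`-th powers; since `e` is prime to
  -- `p`, every element is a `p`-th power.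
  obtain ⟨e, he, hB⟩ := h (R.comap Abelianization.of)
    ⟨by rw [Subgroup.index_comap_of_surjective _ hsurj]; exact hRi.1⟩
  have htop : ∀ a : Abelianization Γ, a ∈ R := fun a => by
    obtain ⟨g, rfl⟩ := hsurj a
    have h1 : (Abelianization.of g) ^ e ∈ R := by simpa using hB g
    have h3 : (Abelianization.of g) ^ (1 : ℤ) ∈ R := by
      have h4 := Nat.gcd_eq_gcd_ab e p
      rw [he.gcd_eq_one] at h4
      rw [Nat.cast_one] at h4
      rw [h4, zpow_add, zpow_mul, zpow_mul]
      exact mul_mem (zpow_mem (by simpa using h1) _) (zpow_mem (by simpa using hpow _) _)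
    simpa using h3
  have hmf : Module.Finite ℤ (Additive (Abelianization Γ)) :=
    Module.Finite.iff_addGroup_fg.2 inferInstance
  -- Nakayama over `ℤ`: an integer congruent to 1 modulo `p`, hence nonzero, kills the
  -- abelianization.
  obtain ⟨r, hr, hr0⟩ := Submodule.exists_sub_one_mem_and_smul_eq_zero_of_fg_of_le_smul
    (Ideal.span {(p : ℤ)}) (⊤ : Submodule ℤ (Additive (Abelianization Γ))) hmf.1 (by
      rintro x -
      obtain ⟨y, hy⟩ := htop x.toMul
      have : x = (p : ℤ) • Additive.ofMul y := by
        apply Additive.toMul.injective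
        rw [← hy]
        simp
      rw [this]
      exact Submodule.smul_mem_smul (Ideal.mem_span_singleton_self _) trivial)
  have hrne : r ≠ 0 := by
    rintro rfl
    rw [Ideal.mem_span_singleton] at hr
    have h5 := Int.natAbs_dvd_natAbs.2 hr
    simp at h5
    exact hp.one_lt.ne' h5
  have hfinab : Finite (Abelianization Γ) := by
    refine CommGroup.finite_of_fg_isMulTorsion _ fun x => ?_
    refine isOfFinOrder_iff_zpow_eq_one.2 ⟨r, hrne, ?_⟩
    exact hr0 (Additive.ofMul x) trivial
  exact Subgroup.finiteIndex_iff_finite_quotient.2 hfinab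

theorem Subgroup.fg_map {Γ Γ' : Type*} [Group Γ] [Group Γ'] (f : Γ →* Γ')
    {H : Subgroup Γ} (h : H.FG) : (H.map f).FG := by
  obtain ⟨S, rfl, hS⟩ := (Subgroup.fg_iff H).1 h
  exact (Subgroup.fg_iff _).2 ⟨Set.image f S, (MonoidHom.map_closure f S).symm, hS.image f⟩

theorem Subgroup.fg_of_relIndex_ne_zero {Γ : Type*} [Group Γ] {H L : Subgroup Γ} (hHL : H ≤ L)
    (hL : L.FG) (h : H.relIndex L ≠ 0) : H.FG := by
  have : Group.FG L := (Group.fg_iff_subgroup_fg L).2 hL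
  have : (H.subgroupOf L).FiniteIndex := ⟨h⟩
  have h1 : (H.subgroupOf L).FG := (Group.fg_iff_subgroup_fg _).1 inferInstance
  have h2 := Subgroup.fg_map L.subtype h1
  rwa [Subgroup.map_subgroupOf_eq_of_le hHL] at h2

open scoped commutatorElement

/-! ### Branch groups: normal subgroups and centralizers. -/

namespace RootedTree

variable {d : ℕ}

theorem sec_conj (g : TreeAut d) {h : TreeAut d} {u : List (Fin d)} (hu : h u = u) :
    sec (g u) (g * h * g⁻¹) = sec u g * sec u h * (sec u g)⁻¹ := by
  rw [sec_mul, sec_mul, sec_inv, inv_apply_apply, hu]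

theorem delta_mul [Nonempty (Fin d)] (v : List (Fin d)) (s t : TreeAut d) :
    delta v (s * t) = delta v s * delta v t := by
  refine eq_of_sec_eq (delta_mem_levelStab v _)
    (mul_mem (delta_mem_levelStab v _) (delta_mem_levelStab v _)) fun u hu => ?_
  rw [sec_mul_of_fixed _ (mem_levelStab.1 (delta_mem_levelStab v t) u hu)]
  by_cases h : u = v
  · subst h
    simp only [sec_delta_self]
  · simp only [sec_delta_of_ne _ hu h, mul_one]

/-- The embedding `delta v` as a homomorphism. -/
def deltaHom [Nonempty (Fin d)] (v : List (Fin d)) : TreeAut d →* TreeAut d :=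
  MonoidHom.mk' (delta v) (delta_mul v)

theorem delta_mem_levelStab_add [Nonempty (Fin d)] (v : List (Fin d)) {s : TreeAut d} {k : ℕ}
    (hs : s ∈ levelStab d k) : delta v s ∈ levelStab d (v.length + k) := by
  refine mem_levelStab_add.2 ⟨delta_mem_levelStab v s, fun u hu => ?_⟩
  by_cases h : u = v
  · subst h
    rwa [sec_delta_self]
  · rw [sec_delta_of_ne _ hu h]
    exact one_mem _

/-- The consequences of being a finitely generated, strongly self-replicating, regular branch group
with the congruence subgroup property that are used below: the branching subgroup can be taken to be
a level stabilizer. -/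
structure IsCongruenceBranch (G : Subgroup (TreeAut d)) : Prop where
  fg : G.FG
  sec_mem : ∀ {g : TreeAut d} {v : List (Fin d)}, g ∈ G → g v = v → sec v g ∈ G
  exists_sec : ∀ (v : List (Fin d)), ∀ g ∈ G, ∃ h ∈ G ⊓ levelStab d v.length, sec v h = g
  transitive : IsLevelTransitive G
  congruence : ∀ H ≤ G, H.relIndex G ≠ 0 → ∃ n : ℕ, G ⊓ levelStab d n ≤ H
  exists_glue : ∃ m : ℕ, ∀ (n : ℕ) (f : List (Fin d) → TreeAut d),
    (∀ v, f v ∈ G ⊓ levelStab d m) → glue n f ∈ G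

theorem glue_mem_of_branching {K : Subgroup (TreeAut d)} [Nonempty (Fin d)]
    (hK : ∀ g ∈ stab ⊤ (level d 1), (∀ x : Fin d, sec [x] g ∈ K) → g ∈ K) (n : ℕ)
    (f : List (Fin d) → TreeAut d) (hf : ∀ v, f v ∈ K) : glue n f ∈ K := by
  induction n generalizing f with
  | zero =>
    have : glue 0 f = f [] := by
      rw [← sec_nil (glue 0 f), sec_glue (n := 0) f rfl]
    rw [this]
    exact hf _
  | succ n ih =>
    have h := (mem_levelStab_add (n := 1) (k := n) (g := glue (n + 1) f)).1 (by
      rw [Nat.add_comm]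
      exact glue_mem_levelStab (n + 1) f)
    refine hK _ h.1 fun x => ?_
    have h2 : sec [x] (glue (n + 1) f) = glue n (fun v => f (x :: v)) := by
      refine eq_of_sec_eq (h.2 [x] rfl) (glue_mem_levelStab _ _) fun v hv => ?_
      rw [sec_glue _ hv, ← sec_append, List.singleton_append, sec_glue _ (by simp [hv])]
    rw [h2]
    exact ih _ fun v => hf _

theorem isCongruenceBranch [Nonempty (Fin d)] {G : Subgroup (TreeAut d)} (hfg : G.FG)
    (hbranch : IsRegularBranch G) (hrep : IsStronglySelfReplicating G)
    (hcsp : HasCongruenceSubgroupProperty G) : IsCongruenceBranch G where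
  fg := hfg
  sec_mem {g v} hg hv := hrep.1 v (mem_secSubgroup.2 ⟨g, hg, hv, rfl⟩)
  exists_sec v g hg := by
    have h := hrep.2 v.length v rfl
    rw [stab_level] at h
    rw [← h] at hg
    obtain ⟨x, hx, -, rfl⟩ := mem_secSubgroup.1 hg
    exact ⟨x, hx, rfl⟩
  transitive := hbranch.2.1
  congruence H hH hi := by
    obtain ⟨n, hn⟩ := hcsp H hH hi
    exact ⟨n, by rwa [← stab_level]⟩
  exists_glue := by
    obtain ⟨-, -, K, hKG, hKi, hK⟩ := hbranch
    obtain ⟨m, hm⟩ := hcsp K hKG hKi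
    rw [stab_level] at hm
    exact ⟨m, fun n f hf => hKG (glue_mem_of_branching hK n f fun v => hm (hf v))⟩

namespace IsCongruenceBranch

variable {G : Subgroup (TreeAut d)}

theorem exists_delta [Nonempty (Fin d)] (hG : IsCongruenceBranch G) : ∃ m : ℕ,
    ∀ (v : List (Fin d)), ∀ s ∈ G ⊓ levelStab d m, delta v s ∈ G := by
  obtain ⟨m, hm⟩ := hG.exists_glue
  refine ⟨m, fun v s hs => hm _ _ fun u => ?_⟩
  split_ifs
  · exact hs
  · exact one_mem _

/-- By the congruence property, the finite quotients of a level stabilizer have exponent dividing a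
power of `d!`, so any prime above `d` shows that its abelianization is finite. -/
theorem exists_le_commutator [Nonempty (Fin d)] (hG : IsCongruenceBranch G) (J : ℕ) :
    ∃ J' : ℕ, G ⊓ levelStab d J' ≤ ⁅G ⊓ levelStab d J, G ⊓ levelStab d J⁆ := by
  set S := G ⊓ levelStab d J with hS
  have hSi : S.relIndex G ≠ 0 := inf_levelStab_relIndex_ne_zero J G
  have hSfg : Group.FG S :=
    (Group.fg_iff_subgroup_fg S).2 (Subgroup.fg_of_relIndex_ne_zero inf_le_left hG.fg hSi)
  obtain ⟨p, hpd, hp⟩ := Nat.exists_infinite_primes (d + 1)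
  have hfi : (commutator S).FiniteIndex := by
    refine commutator_finiteIndex_of_exponent_coprime hp fun B hB => ?_
    have hB1 : (B.map S.subtype).relIndex S ≠ 0 := by
      rw [Subgroup.relIndex, Subgroup.subgroupOf,
        Subgroup.comap_map_eq_self_of_injective S.subtype_injective]
      exact hB.1
    obtain ⟨k, hk⟩ := hG.congruence (B.map S.subtype)
      ((Subgroup.map_subtype_le B).trans inf_le_left) (Subgroup.relIndex_ne_zero_trans hB1 hSi)
    refine ⟨d.factorial ^ k, Nat.Coprime.pow_left _ (Nat.Coprime.symm
      ((Nat.Prime.coprime_iff_not_dvd hp).2 fun h => ?_)), fun g => ?_⟩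
    · have := (Nat.Prime.dvd_factorial hp).1 h
      omega
    · obtain ⟨b, hb, hbg⟩ := hk
        ⟨pow_mem g.2.1 (d.factorial ^ k), pow_mem_levelStab k (g : TreeAut d)⟩
      have : b = g ^ (d.factorial ^ k) := Subtype.ext hbg
      rwa [← this]
  have hle : ⁅S, S⁆ ≤ S := by
    rw [← Subgroup.map_subtype_commutator]
    exact Subgroup.map_subtype_le _
  obtain ⟨n, hn⟩ := hG.congruence ⁅S, S⁆ (hle.trans inf_le_left) (by
    refine Subgroup.relIndex_ne_zero_trans ?_ hSi
    rw [← Subgroup.map_subtype_commutator, Subgroup.relIndex, Subgroup.subgroupOf,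
        Subgroup.comap_map_eq_self_of_injective S.subtype_injective]
    exact hfi.1)
  exact ⟨n, hn⟩

/-- Lift an element moving a letter to a section at level `J`. -/
theorem exists_ne_one [Nontrivial (Fin d)] (hG : IsCongruenceBranch G) (J : ℕ) :
    ∃ g ∈ G ⊓ levelStab d J, g ≠ 1 := by
  obtain ⟨x, y, hxy⟩ := exists_pair_ne (Fin d)
  obtain ⟨g, hg, hgx⟩ := hG.transitive 1 [x] rfl [y] rfl
  obtain ⟨h, hh, hhg⟩ := hG.exists_sec (List.replicate J x) g hg
  refine ⟨h, by simpa using hh, ?_⟩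
  rintro rfl
  rw [sec_one] at hhg
  rw [← hhg] at hgx
  exact hxy (by simpa using hgx)

/-- Double commutator trick: since `a` moves `v`, the commutator of `a` with `(delta v r)⁻¹` lies in
`A` and has section `r` at `v`. Its commutator with `delta v s` lives below `v` only. -/
theorem delta_mem_of_normal [Nonempty (Fin d)] {A : Subgroup (TreeAut d)}
    (hn : ∀ a ∈ A, ∀ g ∈ G, g * a * g⁻¹ ∈ A) {a : TreeAut d} (ha : a ∈ A) {v : List (Fin d)}
    (hav : a v ≠ v) {r s : TreeAut d} (hr : delta v r ∈ G) (hs : delta v s ∈ G) :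
    delta v ⁅r, s⁆ ∈ A := by
  have key : delta v ⁅r, s⁆ = a * (delta v r)⁻¹ * a⁻¹ * delta v r * delta v s *
      (a * (delta v r)⁻¹ * a⁻¹ * delta v r)⁻¹ * (delta v s)⁻¹ := by
    have hR := delta_mem_levelStab v r
    have hS := delta_mem_levelStab v s
    have hY := (levelStab_normal (d := d) v.length).conj_mem _ (inv_mem hR) a
    refine eq_of_sec_eq (delta_mem_levelStab v _)
      (mul_mem (mul_mem (mul_mem (mul_mem hY hR) hS) (inv_mem (mul_mem hY hR))) (inv_mem hS))
      fun u hu => ?_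
    rw [sec_mul_of_fixed _ (mem_levelStab.1 (inv_mem hS) u hu),
      sec_mul_of_fixed _ (mem_levelStab.1 (inv_mem (mul_mem hY hR)) u hu),
      sec_mul_of_fixed _ (mem_levelStab.1 hS u hu),
      sec_inv_of_fixed (mem_levelStab.1 hS u hu),
      sec_inv_of_fixed (mem_levelStab.1 (mul_mem hY hR) u hu),
      sec_mul_of_fixed _ (mem_levelStab.1 hR u hu)]
    by_cases h : u = v
    · subst h
      have h1 : sec u (a * (delta u r)⁻¹ * a⁻¹) = 1 := by
        have h3 : (a⁻¹ u).length = u.length := length_apply _ _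
        have h4 : (delta u r) (a⁻¹ u) = a⁻¹ u := mem_levelStab.1 hR _ h3
        have h2 := sec_conj a (h := (delta u r)⁻¹) (u := a⁻¹ u) (inv_apply_of_fixed h4)
        rw [apply_inv_apply, sec_inv_of_fixed h4, sec_delta_of_ne _ h3 ?_] at h2
        · simpa using h2
        · intro h5
          exact hav (by conv_lhs => rw [← h5, apply_inv_apply])
      rw [h1, sec_delta_self, sec_delta_self, sec_delta_self, commutatorElement_def]
      group
    · simp [sec_delta_of_ne _ hu h]
  rw [key]
  have hX : a * (delta v r)⁻¹ * a⁻¹ * delta v r ∈ A := by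
    have h1 := mul_mem ha (hn _ (inv_mem ha) _ (inv_mem hr))
    simpa [mul_assoc] using h1
  have h2 := mul_mem hX (hn _ (inv_mem hX) _ hs)
  simpa only [mul_assoc] using h2

/-- The double commutators fill a deep level stabilizer below one moved vertex; transitivity carries
this to the whole level, and deep elements are products of such pieces. -/
theorem exists_le_of_normal [Nonempty (Fin d)] (hG : IsCongruenceBranch G)
    {A : Subgroup (TreeAut d)} (hn : ∀ a ∈ A, ∀ g ∈ G, g * a * g⁻¹ ∈ A)
    (hA : A ≠ ⊥) : ∃ j : ℕ, G ⊓ levelStab d j ≤ A := by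
  obtain ⟨⟨a, ha⟩, ha1⟩ := (Subgroup.ne_bot_iff_exists_ne_one.1 hA)
  obtain ⟨v, hv⟩ : ∃ v, a v ≠ v := by
    by_contra! h
    exact ha1 (Subtype.ext (by ext1 v; exact h v))
  obtain ⟨m, hm⟩ := hG.exists_delta
  obtain ⟨m', hm'⟩ := hG.exists_le_commutator m
  have hle : G ⊓ levelStab d m' ≤ G ⊓ levelStab d m := by
    refine hm'.trans ?_
    rw [← Subgroup.map_subtype_commutator]
    exact Subgroup.map_subtype_le _
  have h1 : ∀ t ∈ G ⊓ levelStab d m', delta v t ∈ A := by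
    have h2 : ⁅G ⊓ levelStab d m, G ⊓ levelStab d m⁆ ≤ A.comap (deltaHom v) :=
      Subgroup.commutator_le.2 fun r hr s hs =>
        delta_mem_of_normal hn ha hv (hm v r hr) (hm v s hs)
    exact fun t ht => h2 (hm' ht)
  have h3 : ∀ u : List (Fin d), u.length = v.length → ∀ t ∈ G ⊓ levelStab d m',
      delta u t ∈ A := by
    intro u hu t ht
    obtain ⟨g, hg, hgu⟩ := hG.transitive v.length v rfl u hu
    have hk1 : g⁻¹ * delta u t * g⁻¹⁻¹ ∈ levelStab d (v.length + m') :=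
      (levelStab_normal _).conj_mem _ (hu ▸ delta_mem_levelStab_add u ht.2) _
    have hkG : g⁻¹ * delta u t * g⁻¹⁻¹ ∈ G :=
      mul_mem (mul_mem (inv_mem hg) (hm u t (hle ht))) (inv_mem (inv_mem hg))
    have hkv := fixed_of_mem_levelStab hk1 (v := v) (by omega)
    have h5 := h1 (sec v (g⁻¹ * delta u t * g⁻¹⁻¹))
      ⟨hG.sec_mem hkG hkv, (mem_levelStab_add.1 hk1).2 v rfl⟩
    -- The conjugate of `delta u t` by an element taking `u` to `v` is again supported below `v`
    -- alone.
    have h6 : delta v (sec v (g⁻¹ * delta u t * g⁻¹⁻¹)) = g⁻¹ * delta u t * g⁻¹⁻¹ := by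
      refine eq_of_sec_eq (delta_mem_levelStab _ _) (mem_levelStab_add.1 hk1).1 fun w hw => ?_
      by_cases hwv : w = v
      · rw [hwv, sec_delta_self]
      · rw [sec_delta_of_ne _ hw hwv]
        have hgw : (g w).length = u.length := by rw [length_apply, hw, hu]
        have h7 := sec_conj g⁻¹ (u := g w) (mem_levelStab.1 (delta_mem_levelStab u t) _ hgw)
        rw [inv_apply_apply, sec_delta_of_ne _ hgw ?_] at h7
        · simpa using h7.symm
        · rw [← hgu]
          exact fun h => hwv (g.injective h)
    rw [h6] at h5
    have h8 := hn _ h5 g hg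
    simpa [mul_assoc] using h8
  refine ⟨v.length + m', fun g hg => ?_⟩
  classical
  have hg2 := mem_levelStab_add.1 hg.2
  -- Assemble `g` from its sections, one vertex at a time.
  have h4 : ∀ V : Finset (List (Fin d)), (∀ u ∈ V, u.length = v.length) →
      glue v.length (fun u => if u ∈ V then sec u g else 1) ∈ A := by
    intro V
    induction V using Finset.induction_on with
    | empty =>
      intro _
      convert one_mem A
      exact eq_one_of_sec_eq_one (glue_mem_levelStab _ _) fun u hu => by simp [sec_glue _ hu]
    | insert u V hu ih =>
      intro hV
      have hul := hV u (Finset.mem_insert_self _ _)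
      have h5 := mul_mem (h3 u hul (sec u g)
        ⟨hG.sec_mem hg.1 (mem_levelStab.1 hg2.1 u hul), hg2.2 u hul⟩)
        (ih fun w hw => hV w (Finset.mem_insert_of_mem hw))
      convert h5 using 1
      refine eq_of_sec_eq (glue_mem_levelStab _ _)
        (mul_mem (hul ▸ delta_mem_levelStab u _) (glue_mem_levelStab _ _)) fun w hw => ?_
      rw [sec_mul_of_fixed _ (mem_levelStab.1 (glue_mem_levelStab _ _) w hw), sec_glue _ hw,
        sec_glue _ hw]
      by_cases hwu : w = u
      · subst hwu
        simp [sec_delta_self, hu]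
      · simp [sec_delta_of_ne _ (hw.trans hul.symm) hwu, hwu]
  have h5 := h4 (finite_level d v.length).toFinset (by simp)
  convert h5 using 1
  refine eq_of_sec_eq hg2.1 (glue_mem_levelStab _ _) fun u hu => ?_
  simp [sec_glue _ hu, hu]

/-- Otherwise the centralizer, being normalized by `G`, contains a level stabilizer, so some deeper
one is abelian, against `exists_le_commutator`. -/
theorem eq_one_of_commute [Nontrivial (Fin d)] (hG : IsCongruenceBranch G) {j : ℕ} {c : TreeAut d}
    (hc : c ∈ G) (h : ∀ s ∈ G ⊓ levelStab d j, s * c = c * s) : c = 1 := by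
  by_contra hc1
  obtain ⟨i, hi⟩ := hG.exists_le_of_normal
    (A := G ⊓ Subgroup.centralizer (G ⊓ levelStab d j : Subgroup _)) (by
      rintro a ⟨haG, ha⟩ g hg
      refine ⟨G.mul_mem (G.mul_mem hg haG) (G.inv_mem hg),
        Subgroup.mem_centralizer_iff.2 fun s hs => ?_⟩
      have h1 := Subgroup.mem_centralizer_iff.1 ha (g⁻¹ * s * g) 
        ⟨G.mul_mem (G.mul_mem (G.inv_mem hg) hs.1) hg,
        by simpa using (levelStab_normal j).conj_mem _ hs.2 g⁻¹⟩
      calc s * (g * a * g⁻¹) = g * ((g⁻¹ * s * g) * a) * g⁻¹ := by group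
        _ = g * (a * (g⁻¹ * s * g)) * g⁻¹ := by rw [h1]
        _ = _ := by group)
    (fun hb => hc1 (by
      have : c ∈ (⊥ : Subgroup (TreeAut d)) := hb ▸ ⟨hc, Subgroup.mem_centralizer_iff.2 h⟩
      exact this))
  obtain ⟨J, hJ⟩ := hG.exists_le_commutator (max i j)
  have h2 : ⁅G ⊓ levelStab d (max i j), G ⊓ levelStab d (max i j)⁆ ≤ ⊥ := by
    refine (Subgroup.commutator_eq_bot_iff_le_centralizer.2 ?_).le
    intro x hx
    refine Subgroup.mem_centralizer_iff.2 fun y hy => ?_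
    exact Subgroup.mem_centralizer_iff.1
      (hi ⟨hx.1, levelStab_antitone (le_max_left i j) hx.2⟩).2 y
      ⟨hy.1, levelStab_antitone (le_max_right i j) hy.2⟩
  obtain ⟨g, hg, hg1⟩ := hG.exists_ne_one J
  exact hg1 (h2 (hJ hg))

end IsCongruenceBranch

end RootedTree

/-! ### Transversals and finite index. -/

theorem Subgroup.exists_finite_transversal {Γ : Type*} [Group Γ] {M R : Subgroup Γ}
    (h : M.relIndex R ≠ 0) :
    ∃ T : Set Γ, T.Finite ∧ T ⊆ R ∧ ∀ g ∈ R, ∃ t ∈ T, t⁻¹ * g ∈ M := by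
  have : Finite (R ⧸ M.subgroupOf R) := Subgroup.index_ne_zero_iff_finite.1 h
  refine ⟨Set.range fun x : R ⧸ M.subgroupOf R => ((Quotient.out x : R) : Γ),
    Set.finite_range _, ?_, fun g hg => ⟨_, ⟨QuotientGroup.mk ⟨g, hg⟩, rfl⟩, ?_⟩⟩
  · rintro _ ⟨x, rfl⟩
    exact SetLike.coe_mem _
  · have h1 := QuotientGroup.eq.1
      (QuotientGroup.out_eq' (QuotientGroup.mk (s := M.subgroupOf R) ⟨g, hg⟩))
    exact h1

/-- A group with a finitely generated subgroup of finite index is finitely generated. -/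
theorem Subgroup.fg_of_fg_of_relIndex_ne_zero {Γ : Type*} [Group Γ] {H L : Subgroup Γ}
    (hHL : H ≤ L) (hH : H.FG) (h : H.relIndex L ≠ 0) : L.FG := by
  obtain ⟨T, hTf, hTL, hT⟩ := Subgroup.exists_finite_transversal h
  obtain ⟨S, rfl, hSf⟩ := (Subgroup.fg_iff H).1 hH
  refine (Subgroup.fg_iff L).2 ⟨S ∪ T, le_antisymm ?_ fun g hg => ?_, hSf.union hTf⟩
  · exact (Subgroup.closure_le _).2 (Set.union_subset ((Subgroup.closure_le _).1 hHL) hTL)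
  · obtain ⟨t, ht, htg⟩ := hT g hg
    have h1 : t ∈ Subgroup.closure (S ∪ T) := Subgroup.subset_closure (Or.inr ht)
    simpa using mul_mem h1 (Subgroup.closure_mono (Set.subset_union_left (t := T)) htg)

theorem Subgroup.relIndex_ne_zero_of_le_left {Γ : Type*} [Group Γ] {H K L : Subgroup Γ}
    (hHK : H ≤ K) (h : H.relIndex L ≠ 0) : K.relIndex L ≠ 0 := fun h0 =>
  h (Subgroup.relIndex_eq_zero_of_le_left hHK h0)

namespace RootedTree

variable {d : ℕ}

/-! ### Full subgroups -/

/-- Taking the section at `v`, as a homomorphism on the stabilizer of `v`. -/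
def secHom (v : List (Fin d)) : stab (⊤ : Subgroup (TreeAut d)) {v} →* TreeAut d :=
  MonoidHom.mk' (fun g => sec v (g : TreeAut d)) fun _ h => sec_mul_of_fixed _ (h.2.2 v rfl)

theorem secSubgroup_eq_map (v : List (Fin d)) (H : Subgroup (TreeAut d)) :
    secSubgroup v H = (H.subgroupOf (stab ⊤ {v})).map (secHom v) := by
  ext x
  rw [mem_secSubgroup]
  constructor
  · rintro ⟨g, hg, hv, rfl⟩
    exact ⟨⟨g, trivial, fun w hw => by rw [Set.mem_singleton_iff.1 hw, hv]⟩, hg, rfl⟩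
  · rintro ⟨g, hg, rfl⟩
    exact ⟨g, hg, g.2.2 v rfl, rfl⟩

theorem secSubgroup_relIndex_ne_zero (v : List (Fin d)) {H L : Subgroup (TreeAut d)}
    (h : H.relIndex L ≠ 0) : (secSubgroup v H).relIndex (secSubgroup v L) ≠ 0 := by
  rw [secSubgroup_eq_map, secSubgroup_eq_map, ← Subgroup.relIndex_comap]
  exact Subgroup.relIndex_ne_zero_of_le_left (Subgroup.le_comap_map _ _)
    (Subgroup.relIndex_comap_ne_zero _ h)

/-- The pointwise stabilizer of the subtrees below the vertices of `E`. -/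
def fixBelow (E : Set (List (Fin d))) : Subgroup (TreeAut d) :=
  stab ⊤ {u | ∃ w ∈ E, w <+: u}

theorem mem_fixBelow {E : Set (List (Fin d))} {g : TreeAut d} :
    g ∈ fixBelow E ↔ ∀ w ∈ E, g w = w ∧ sec w g = 1 := by
  constructor
  · refine fun h w hw => ?_
    have h1 : g w = w := h.2 w ⟨w, hw, List.prefix_rfl⟩
    refine ⟨h1, sec_eq_iff.2 fun u => ?_⟩
    rw [h1]
    exact h.2 _ ⟨w, hw, List.prefix_append _ _⟩
  · refine fun h => ⟨trivial, ?_⟩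
    rintro _ ⟨w, hw, u, rfl⟩
    rw [apply_append_sec, (h w hw).1, (h w hw).2]
    rfl

theorem sec_commutator {a b : TreeAut d} {v : List (Fin d)} (ha : a v = v) (hb : b v = v) :
    sec v ⁅a, b⁆ = ⁅sec v a, sec v b⁆ := by
  rw [commutatorElement_def, sec_mul_of_fixed _ (inv_apply_of_fixed hb),
    sec_mul_of_fixed _ (inv_apply_of_fixed ha), sec_mul_of_fixed _ hb, sec_inv_of_fixed ha,
    sec_inv_of_fixed hb, commutatorElement_def]

/-- The subgroup `H ≤ G` is full if, on some level, all its sections have finite index in `G`. -/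
def IsFull (G H : Subgroup (TreeAut d)) : Prop :=
  H ≤ G ∧ ∃ n : ℕ, ∀ v : List (Fin d), v.length = n → (secSubgroup v H).relIndex G ≠ 0

theorem IsFull.mono {G H L : Subgroup (TreeAut d)} (h : IsFull G H) (hHL : H ≤ L) (hL : L ≤ G) :
    IsFull G L := by
  obtain ⟨-, n, hn⟩ := h
  exact ⟨hL, n, fun v hv =>
    Subgroup.relIndex_ne_zero_of_le_left (secSubgroup_mono v hHL) (hn v hv)⟩

theorem IsFull.of_relIndex_ne_zero {G H L : Subgroup (TreeAut d)} (h : IsFull G L) (hHL : H ≤ L)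
    (hi : H.relIndex L ≠ 0) : IsFull G H := by
  obtain ⟨hL, n, hn⟩ := h
  exact ⟨hHL.trans hL, n, fun v hv =>
    Subgroup.relIndex_ne_zero_trans (secSubgroup_relIndex_ne_zero v hi) (hn v hv)⟩

/-- On level `n` the sections of `H` have finite index in `G`, and on level `N` the sections of
the stabilizer of level `n` in `H` are all of `G`. -/
structure IsBase (G H : Subgroup (TreeAut d)) (n N : ℕ) : Prop where
  le : H ≤ G
  level_le : n ≤ N
  relIndex_ne_zero : ∀ v : List (Fin d), v.length = n → (secSubgroup v H).relIndex G ≠ 0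
  exists_sec : ∀ w : List (Fin d), w.length = N → ∀ g ∈ G, ∃ h ∈ H ⊓ levelStab d n,
    h w = w ∧ sec w h = g

/-- The vertices `w` of level `N` that are determined by `v` in `L`: an element of `L` that fixes
level `N` and has trivial section at `v` has trivial section at `w`. -/
def determined (L : Subgroup (TreeAut d)) (N : ℕ) (v : List (Fin d)) : Set (List (Fin d)) :=
  {w | w.length = N ∧ ∀ g ∈ L ⊓ levelStab d N, sec v g = 1 → sec w g = 1}

theorem determined_anti {L L' : Subgroup (TreeAut d)} (h : L ≤ L') (N : ℕ) (v : List (Fin d)) :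
    determined L' N v ⊆ determined L N v := fun _ hw =>
  ⟨hw.1, fun g hg => hw.2 g ⟨h hg.1, hg.2⟩⟩

/-- The elements of `L` fixing level `N` whose section is trivial at all vertices of level `N` that
are not determined by `v`. -/
def freePart (L : Subgroup (TreeAut d)) (N : ℕ) (v : List (Fin d)) : Subgroup (TreeAut d) :=
  L ⊓ levelStab d N ⊓ fixBelow {w | w.length = N ∧ w ∉ determined L N v}

variable {G : Subgroup (TreeAut d)}

namespace IsCongruenceBranch

theorem secSubgroup_le (hG : IsCongruenceBranch G) {H : Subgroup (TreeAut d)} (hH : H ≤ G)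
    (v : List (Fin d)) : secSubgroup v H ≤ G := by
  intro x hx
  obtain ⟨g, hg, hv, rfl⟩ := mem_secSubgroup.1 hx
  exact hG.sec_mem (hH hg) hv

theorem secSubgroup_self (hG : IsCongruenceBranch G) (v : List (Fin d)) :
    secSubgroup v G = G := by
  refine le_antisymm (hG.secSubgroup_le le_rfl v) fun g hg => ?_
  obtain ⟨h, hh, rfl⟩ := hG.exists_sec v g hg
  exact mem_secSubgroup.2 ⟨h, hh.1, mem_levelStab.1 hh.2 v rfl, rfl⟩

theorem secSubgroup_relIndex_self (hG : IsCongruenceBranch G) (v : List (Fin d))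
    {H : Subgroup (TreeAut d)} (h : H.relIndex G ≠ 0) : (secSubgroup v H).relIndex G ≠ 0 := by
  have := secSubgroup_relIndex_ne_zero v h
  rwa [hG.secSubgroup_self] at this

theorem exists_isBase [Nonempty (Fin d)] (hG : IsCongruenceBranch G) {H : Subgroup (TreeAut d)}
    (hH : IsFull G H) : ∃ n N : ℕ, IsBase G H n N := by
  obtain ⟨hle, n, hn⟩ := hH
  have h1 : ∀ v : List (Fin d), v.length = n →
      (secSubgroup v (H ⊓ levelStab d n)).relIndex G ≠ 0 := fun v hv =>
    Subgroup.relIndex_ne_zero_trans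
      (secSubgroup_relIndex_ne_zero v (inf_levelStab_relIndex_ne_zero n H)) (hn v hv)
  have h2 : ∀ v : List (Fin d), ∃ k : ℕ, v.length = n →
      G ⊓ levelStab d k ≤ secSubgroup v (H ⊓ levelStab d n) := fun v => by
    by_cases hv : v.length = n
    · obtain ⟨k, hk⟩ := hG.congruence _ (hG.secSubgroup_le (inf_le_left.trans hle) v) (h1 v hv)
      exact ⟨k, fun _ => hk⟩
    · exact ⟨0, fun h => absurd h hv⟩
  choose k hk using h2
  obtain ⟨K, hK⟩ := ((finite_level d n).image k).bddAbove
  -- `K` bounds the depths at which the sections of `H` on level `n` absorb the level stabilizers of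
  -- `G`. Any `g` lifts to a section `y` fixing `K` levels, and `y` is a section of `H`.
  refine ⟨n, n + K, hle, Nat.le_add_right _ _, hn, fun w hw g hg => ?_⟩
  have hv : (w.take n).length = n := by simp [hw]
  have hu : (w.drop n).length = K := by simp [hw]
  obtain ⟨y, hy, hyg⟩ := hG.exists_sec (w.drop n) g hg
  rw [hu] at hy
  obtain ⟨h, hh, hhv, hhy⟩ := mem_secSubgroup.1 (hk _ hv ⟨hy.1,
    levelStab_antitone (hK ⟨_, hv, rfl⟩) hy.2⟩)
  refine ⟨h, hh, ?_, ?_⟩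
  · rw [← List.take_append_drop n w, apply_append_sec, hhv, hhy, mem_levelStab.1 hy.2 _ hu]
  · rw [← List.take_append_drop n w, sec_append, hhy, hyg]

section Base

variable {H L : Subgroup (TreeAut d)} {n N : ℕ} {v : List (Fin d)}

theorem exists_le_secSubgroup_inf [Nonempty (Fin d)] (hG : IsCongruenceBranch G)
    (hb : IsBase G H n N) (hHL : H ≤ L) (hL : L ≤ G) (hv : v.length = n) (k : ℕ) :
    ∃ j : ℕ, G ⊓ levelStab d j ≤ secSubgroup v (L ⊓ levelStab d k) := by
  refine hG.congruence _ (hG.secSubgroup_le (inf_le_left.trans hL) v) ?_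
  exact Subgroup.relIndex_ne_zero_trans
    (secSubgroup_relIndex_ne_zero v (inf_levelStab_relIndex_ne_zero k L))
    (Subgroup.relIndex_ne_zero_of_le_left (secSubgroup_mono v hHL) (hb.relIndex_ne_zero v hv))

/-- This group of sections is normalized by `G`, because each element of `G` is the section at `w`
of an element of `H` fixing `v`. It is nontrivial exactly because `v` does not determine `w`. -/
theorem exists_le_of_notMem_determined [Nonempty (Fin d)] (hG : IsCongruenceBranch G)
    (hb : IsBase G H n N) (hHL : H ≤ L) (hv : v.length = n) {w : List (Fin d)}
    (hw : w.length = N) (hwv : w ∉ determined L N v) :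
    ∃ j : ℕ, G ⊓ levelStab d j ≤ secSubgroup w (L ⊓ levelStab d N ⊓ fixBelow {v}) := by
  refine hG.exists_le_of_normal ?_ ?_
  · intro a ha g hg
    obtain ⟨r, ⟨⟨hrL, hrN⟩, hrv⟩, hrw, rfl⟩ := mem_secSubgroup.1 ha
    obtain ⟨h, hh, hhw, rfl⟩ := hb.exists_sec w hw g hg
    have hrv' := mem_fixBelow.1 hrv v rfl
    have hhv : h v = v := mem_levelStab.1 hh.2 v hv
    have h1 : h * r * h⁻¹ ∈ levelStab d N := (levelStab_normal N).conj_mem _ hrN h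
    refine mem_secSubgroup.2 ⟨h * r * h⁻¹, ⟨⟨L.mul_mem (L.mul_mem (hHL hh.1) hrL)
      (L.inv_mem (hHL hh.1)), h1⟩, mem_fixBelow.2 ?_⟩, mem_levelStab.1 h1 w hw, ?_⟩
    · rintro _ rfl
      refine ⟨fixed_of_mem_levelStab h1 (hv.trans_le hb.level_le), ?_⟩
      have h2 := sec_conj h hrv'.1
      rw [hhv, hrv'.2] at h2
      simpa using h2
    · have h2 := sec_conj h hrw
      rwa [hhw] at h2
  · intro h0
    refine hwv ⟨hw, fun g hg hgv => ?_⟩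
    have : sec w g ∈ secSubgroup w (L ⊓ levelStab d N ⊓ fixBelow {v}) := by
      refine mem_secSubgroup.2 ⟨g, ⟨hg, mem_fixBelow.2 ?_⟩, mem_levelStab.1 hg.2 w hw, rfl⟩
      rintro _ rfl
      exact ⟨fixed_of_mem_levelStab hg.2 (hv.trans_le hb.level_le), hgv⟩
    rw [h0] at this
    exact this

/-- Vertices are killed one at a time: a commutator of an element trivial on `E` with one trivial at
`w` is trivial at both. The loss at `v` is only a passage to commutators, which still contain a
level stabilizer. -/
theorem exists_le_secSubgroup_fixBelow [Nonempty (Fin d)] (hG : IsCongruenceBranch G)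
    (hb : IsBase G H n N) (hHL : H ≤ L) (hL : L ≤ G) (hv : v.length = n)
    (E : Finset (List (Fin d))) (hE : ∀ w ∈ E, w.length = N ∧ w ∉ determined L N v) :
    ∃ j : ℕ, G ⊓ levelStab d j ≤ secSubgroup v (L ⊓ levelStab d N ⊓ fixBelow (E : Set _)) := by
  classical
  induction E using Finset.induction_on with
  | empty =>
    obtain ⟨j, hj⟩ := hG.exists_le_secSubgroup_inf hb hHL hL hv N
    refine ⟨j, hj.trans (secSubgroup_mono v (le_inf le_rfl fun g _ => mem_fixBelow.2 ?_))⟩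
    simp
  | insert w E hw ih =>
    obtain ⟨j₁, hj₁⟩ := ih fun u hu => hE u (Finset.mem_insert_of_mem hu)
    obtain ⟨hwN, hwv⟩ := hE w (Finset.mem_insert_self _ _)
    obtain ⟨k, hk⟩ := hG.exists_le_of_notMem_determined hb hHL hv hwN hwv
    obtain ⟨j₂, hj₂⟩ := hG.exists_le_secSubgroup_inf hb hHL hL hv (N + k)
    obtain ⟨j, hj⟩ := hG.exists_le_commutator (max j₁ j₂)
    refine ⟨j, hj.trans (Subgroup.commutator_le.2 fun r hr s hs => ?_)⟩
    obtain ⟨q, ⟨⟨hqL, hqN⟩, hqE⟩, hqv, rfl⟩ := mem_secSubgroup.1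
      (hj₁ ⟨hr.1, levelStab_antitone (le_max_left _ _) hr.2⟩)
    obtain ⟨g, ⟨hgL, hgN⟩, hgv, rfl⟩ := mem_secSubgroup.1
      (hj₂ ⟨hs.1, levelStab_antitone (le_max_right _ _) hs.2⟩)
    obtain ⟨hgN', hgk⟩ := mem_levelStab_add.1 hgN
    obtain ⟨t, ⟨⟨htL, htN⟩, htv⟩, htw, htg⟩ := mem_secSubgroup.1
      (hk ⟨hG.sec_mem (hL hgL) (mem_levelStab.1 hgN' w hwN), hgk w hwN⟩)
    have htv' := mem_fixBelow.1 htv v rfl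
    -- `t` agrees with `g` at `w` and is trivial at `v`, so dividing by it kills `w` without
    -- changing the section at `v`.
    set h := g * t⁻¹ with hh
    have hhL : h ∈ L := L.mul_mem hgL (L.inv_mem htL)
    have hhN : h ∈ levelStab d N := mul_mem hgN' (inv_mem htN)
    have hhv : sec v h = sec v g := by
      rw [hh, sec_mul_of_fixed _ (inv_apply_of_fixed htv'.1), sec_inv_of_fixed htv'.1, htv'.2]
      simp
    have hhw : sec w h = 1 := by
      rw [hh, sec_mul_of_fixed _ (inv_apply_of_fixed htw), sec_inv_of_fixed htw, htg]
      simp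
    have hhv' : h v = v := fixed_of_mem_levelStab hhN (hv.trans_le hb.level_le)
    have hcN : ⁅q, h⁆ ∈ levelStab d N :=
      mul_mem (mul_mem (mul_mem hqN hhN) (inv_mem hqN)) (inv_mem hhN)
    refine mem_secSubgroup.2 ⟨⁅q, h⁆, ⟨⟨L.mul_mem (L.mul_mem (L.mul_mem hqL hhL) (L.inv_mem hqL))
      (L.inv_mem hhL), hcN⟩, mem_fixBelow.2 fun u hu => ?_⟩, ?_, ?_⟩
    · have huN : u.length = N := (hE u hu).1
      refine ⟨mem_levelStab.1 hcN u huN, ?_⟩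
      rw [sec_commutator (mem_levelStab.1 hqN u huN) (mem_levelStab.1 hhN u huN)]
      rcases Finset.mem_insert.1 hu with rfl | hu
      · rw [hhw, commutatorElement_one_right]
      · rw [(mem_fixBelow.1 hqE u hu).2, commutatorElement_one_left]
    · exact fixed_of_mem_levelStab hcN (hv.trans_le hb.level_le)
    · rw [sec_commutator hqv hhv', hhv]

theorem exists_le_secSubgroup_freePart [Nonempty (Fin d)] (hG : IsCongruenceBranch G)
    (hb : IsBase G H n N) (hHL : H ≤ L) (hL : L ≤ G) (hv : v.length = n) :
    ∃ j : ℕ, G ⊓ levelStab d j ≤ secSubgroup v (freePart L N v) := by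
  have hfin : {w : List (Fin d) | w.length = N ∧ w ∉ determined L N v}.Finite :=
    (finite_level d N).subset fun w hw => hw.1
  have := hG.exists_le_secSubgroup_fixBelow hb hHL hL hv hfin.toFinset (by simp)
  rwa [hfin.coe_toFinset] at this

/-- Elements of the free part are therefore recovered from their section at `v`. -/
theorem eq_one_of_mem_freePart [Nonempty (Fin d)] {q : TreeAut d} (hq : q ∈ freePart L N v)
    (hqv : sec v q = 1) : q = 1 := by
  refine eq_one_of_sec_eq_one hq.1.2 fun w hw => ?_
  by_cases hwv : w ∈ determined L N v
  · exact hwv.2 q hq.1 hqv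
  · exact (mem_fixBelow.1 hq.2 w ⟨hw, hwv⟩).2

/-- The depth `J` depends on `L` only. A deep element of `L'` is divided successively by elements of
the free parts until all its sections on level `N` vanish. -/
theorem exists_inf_levelStab_le [Nonempty (Fin d)] (hG : IsCongruenceBranch G)
    (hb : IsBase G H n N) (hHL : H ≤ L) (hL : L ≤ G) :
    ∃ J : ℕ, ∀ L' ≤ G, L ≤ L' →
      (∀ v : List (Fin d), v.length = n → determined L N v ⊆ determined L' N v) →
      ∀ Q : Subgroup (TreeAut d), (∀ v : List (Fin d), v.length = n → freePart L N v ≤ Q) →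
        L' ⊓ levelStab d J ≤ Q := by
  have h2 : ∀ v : List (Fin d), ∃ k : ℕ, v.length = n →
      G ⊓ levelStab d k ≤ secSubgroup v (freePart L N v) := fun v => by
    by_cases hv : v.length = n
    · obtain ⟨k, hk⟩ := hG.exists_le_secSubgroup_freePart hb hHL hL hv
      exact ⟨k, fun _ => hk⟩
    · exact ⟨0, fun h => absurd h hv⟩
  choose k hk using h2
  obtain ⟨K, hK⟩ := ((finite_level d n).image k).bddAbove
  refine ⟨N + K, fun L' hL' hLL' hdet Q hQ p hp => ?_⟩
  classical
  have key : ∀ V : Finset (List (Fin d)), (∀ v ∈ V, v.length = n) →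
      ∃ q ∈ Q, q⁻¹ * p ∈ L' ⊓ levelStab d (N + K) ∧
        ∀ v ∈ V, ∀ w ∈ determined L N v, sec w (q⁻¹ * p) = 1 := by
    intro V
    induction V using Finset.induction_on with
    | empty => exact fun _ => ⟨1, one_mem _, by simpa using hp, by simp⟩
    | insert v V hvV ih =>
      intro hV
      have hv := hV v (Finset.mem_insert_self _ _)
      obtain ⟨q, hq, hqp, hqV⟩ := ih fun u hu => hV u (Finset.mem_insert_of_mem hu)
      set p' := q⁻¹ * p with hp'
      obtain ⟨hp'N, hp'K⟩ := mem_levelStab_add.1 hqp.2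
      have hp'v : p' v = v := fixed_of_mem_levelStab hp'N (hv.trans_le hb.level_le)
      have hsv : sec v p' ∈ levelStab d (k v) := by
        have h3 : p' ∈ levelStab d (n + k v) :=
          levelStab_antitone (Nat.add_le_add hb.level_le (hK ⟨v, hv, rfl⟩)) hqp.2
        exact (mem_levelStab_add.1 h3).2 v hv
      obtain ⟨t, ht, htv, htp⟩ := mem_secSubgroup.1 (hk v hv ⟨hG.sec_mem (hL' hqp.1) hp'v, hsv⟩)
      have htN := ht.1.2
      have hnew : t⁻¹ * p' ∈ L' ⊓ levelStab d N :=
        ⟨L'.mul_mem (L'.inv_mem (hLL' ht.1.1)) hqp.1,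
          (levelStab d N).mul_mem ((levelStab d N).inv_mem htN) hp'N⟩
      have hnewv : sec v (t⁻¹ * p') = 1 := by
        rw [sec_mul_of_fixed _ hp'v, sec_inv_of_fixed htv, htp, inv_mul_cancel]
      -- Here equality of determined sets is used: triviality at `v` spreads inside `L'` to all
      -- vertices that `v` determines in `L`.
      have hin : ∀ w ∈ determined L N v, sec w (t⁻¹ * p') = 1 := fun w hw =>
        (hdet v hv hw).2 _ hnew hnewv
      have hout : ∀ w : List (Fin d), w.length = N → w ∉ determined L N v →
          sec w (t⁻¹ * p') = sec w p' := fun w hw hwd => by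
        have h4 := mem_fixBelow.1 ht.2 w ⟨hw, hwd⟩
        rw [sec_mul_of_fixed _ (mem_levelStab.1 hp'N w hw), sec_inv_of_fixed h4.1, h4.2]
        simp
      refine ⟨q * t, mul_mem hq (hQ v hv ht), ?_, ?_⟩
      · rw [mul_inv_rev, mul_assoc]
        refine ⟨hnew.1, mem_levelStab_add.2 ⟨hnew.2, fun w hw => ?_⟩⟩
        by_cases hwd : w ∈ determined L N v
        · rw [← hp', hin w hwd]
          exact one_mem _
        · rw [← hp', hout w hw hwd]
          exact hp'K w hw
      · intro u hu w hw
        rw [mul_inv_rev, mul_assoc, ← hp']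
        by_cases hwd : w ∈ determined L N v
        · exact hin w hwd
        · rw [hout w hw.1 hwd]
          rcases Finset.mem_insert.1 hu with rfl | hu
          · exact absurd hw hwd
          · exact hqV u hu w hw
  obtain ⟨q, hq, hqp, hqV⟩ := key (finite_level d n).toFinset (by simp)
  have h1 : q⁻¹ * p = 1 := by
    refine eq_one_of_sec_eq_one (mem_levelStab_add.1 hqp.2).1 fun w hw => ?_
    -- Every vertex of level `N` is determined by its ancestor on level `n`.
    refine hqV (w.take n) (by simpa [hw] using hb.level_le) w ⟨hw, fun g _ hgv => ?_⟩
    rw [← List.take_append_drop n w, sec_append, hgv, sec_one]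
  rwa [← inv_mul_eq_one.1 h1]

theorem freePart_le (L : Subgroup (TreeAut d)) (N : ℕ) (v : List (Fin d)) : freePart L N v ≤ L :=
  inf_le_left.trans inf_le_left

/-- Taking the section at `v` embeds the free part onto a finite index subgroup of `G`. -/
theorem freePart_fg [Nonempty (Fin d)] (hG : IsCongruenceBranch G)
    (hb : IsBase G H n N) (hHL : H ≤ L) (hL : L ≤ G) (hv : v.length = n) :
    (freePart L N v).FG := by
  obtain ⟨j, hj⟩ := hG.exists_le_secSubgroup_freePart hb hHL hL hv
  have hfix : ∀ g ∈ freePart L N v, g v = v := fun g hg =>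
    fixed_of_mem_levelStab hg.1.2 (hv.trans_le hb.level_le)
  have h1 : (secSubgroup v (freePart L N v)).FG := by
    refine Subgroup.fg_of_relIndex_ne_zero
      (hG.secSubgroup_le ((freePart_le L N v).trans hL) v) hG.fg ?_
    exact Subgroup.relIndex_ne_zero_of_le_left hj (inf_levelStab_relIndex_ne_zero j G)
  let f : freePart L N v →* TreeAut d :=
    MonoidHom.mk' (fun g => sec v (g : TreeAut d)) fun _ h => sec_mul_of_fixed _ (hfix h h.2)
  have hinj : Function.Injective f := (injective_iff_map_eq_one f).2 fun q hq =>
    Subtype.ext (eq_one_of_mem_freePart q.2 hq)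
  have hr : f.range = secSubgroup v (freePart L N v) := by
    ext x
    rw [mem_secSubgroup]
    exact ⟨fun ⟨g, hg⟩ => ⟨g, g.2, hfix g g.2, hg⟩, fun ⟨g, hg, _, hx⟩ => ⟨⟨g, hg⟩, hx⟩⟩
  rw [← hr] at h1
  have h2 : Group.FG f.range := (Group.fg_iff_subgroup_fg _).2 h1
  have h3 : Group.FG (freePart L N v) :=
    Group.fg_of_surjective (f := (MonoidHom.ofInjective hinj).symm.toMonoidHom)
      (MonoidHom.ofInjective hinj).symm.surjective
  exact (Group.fg_iff_subgroup_fg _).1 h3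

end Base

/-- The finitely many free parts generate a subgroup of finite index. -/
theorem fg_of_isFull [Nonempty (Fin d)] (hG : IsCongruenceBranch G) {H : Subgroup (TreeAut d)}
    (hH : IsFull G H) : H.FG := by
  obtain ⟨n, N, hb⟩ := hG.exists_isBase hH
  obtain ⟨J, hJ⟩ := hG.exists_inf_levelStab_le hb le_rfl hb.le
  set Q := ⨆ v ∈ {v : List (Fin d) | v.length = n}, freePart H N v with hQ
  have hQfg : Q.FG := Subgroup.FG.biSup (finite_level d n) _ fun v hv =>
    hG.freePart_fg hb le_rfl hb.le hv
  refine Subgroup.fg_of_fg_of_relIndex_ne_zero (iSup₂_le fun v _ => freePart_le H N v) hQfg ?_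
  exact Subgroup.relIndex_ne_zero_of_le_left (hJ H hb.le le_rfl (fun _ _ => subset_rfl) Q
    fun v hv => le_iSup₂_of_le v hv le_rfl) (inf_levelStab_relIndex_ne_zero J H)

/-- Passing to the normalizer loses no determined vertex. If `g` normalizes `M` and is trivial at
`v`, its commutators with elements of `M` lie in `M` and are trivial at `v`, hence at `w`. So the
section of `g` at `w` centralizes a level stabilizer and is trivial. -/
theorem relIndex_normalizer_ne_zero [Nontrivial (Fin d)] (hG : IsCongruenceBranch G)
    {M : Subgroup (TreeAut d)} (hM : IsFull G M) :
    M.relIndex (G ⊓ Subgroup.normalizer (M : Set (TreeAut d))) ≠ 0 := by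
  obtain ⟨n, N, hb⟩ := hG.exists_isBase hM
  obtain ⟨J, hJ⟩ := hG.exists_inf_levelStab_le hb le_rfl hb.le
  set L := G ⊓ Subgroup.normalizer (M : Set (TreeAut d)) with hL
  have hML : M ≤ L := le_inf hb.le Subgroup.le_normalizer
  refine Subgroup.relIndex_ne_zero_of_le_left (hJ L inf_le_left hML ?_ M
    fun v _ => freePart_le M N v) (inf_levelStab_relIndex_ne_zero J L)
  refine fun v hv w hw => ⟨hw.1, fun g hg hgv => ?_⟩
  have hgv' : g v = v := fixed_of_mem_levelStab hg.2 (hv.trans_le hb.level_le)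
  have hgw : g w = w := mem_levelStab.1 hg.2 w hw.1
  have hfi : (secSubgroup w (M ⊓ levelStab d N)).relIndex G ≠ 0 := by
    refine Subgroup.relIndex_ne_zero_trans
      (secSubgroup_relIndex_ne_zero w (inf_levelStab_relIndex_ne_zero N M)) ?_
    rw [← List.take_append_drop n w, secSubgroup_append]
    exact hG.secSubgroup_relIndex_self _
      (hb.relIndex_ne_zero _ (by simpa [hw.1] using hb.level_le))
  obtain ⟨j, hj⟩ := hG.congruence _ (hG.secSubgroup_le (inf_le_left.trans hb.le) w) hfi
  refine hG.eq_one_of_commute (j := j) (hG.sec_mem hg.1.1 hgw) fun s hs => ?_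
  obtain ⟨p, hp, hpw, rfl⟩ := mem_secSubgroup.1 (hj hs)
  have hpv : p v = v := fixed_of_mem_levelStab hp.2 (hv.trans_le hb.level_le)
  have hc : ⁅g, p⁆ ∈ M ⊓ levelStab d N :=
    ⟨M.mul_mem ((Subgroup.mem_normalizer_iff.1 hg.1.2 p).1 hp.1) (M.inv_mem hp.1),
      (levelStab d N).mul_mem ((levelStab_normal N).conj_mem _ hp.2 g)
        ((levelStab d N).inv_mem hp.2)⟩
  have h1 := hw.2 _ hc (by rw [sec_commutator hgv' hpv, hgv, commutatorElement_one_left])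
  rw [sec_commutator hgw hpw, commutatorElement_eq_one_iff_mul_comm] at h1
  exact h1.symm

end IsCongruenceBranch

end RootedTree

open scoped Topology

/-! ### The space of subgroups -/

section SubgroupSpace

variable {Γ : Type*} [Group Γ]

theorem mem_nhds_subgroup {H : Subgroup Γ} {s : Set (Subgroup Γ)} :
    s ∈ 𝓝 H ↔ ∃ F : Set Γ, F.Finite ∧ {L : Subgroup Γ | ∀ g ∈ F, g ∈ L ↔ g ∈ H} ⊆ s := by
  classical
  constructor
  · intro hs
    obtain ⟨t, ht, hts⟩ := (mem_nhds_induced _ H s).1 hs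
    obtain ⟨u, hut, hu, hHu⟩ := mem_nhds_iff.1 ht
    obtain ⟨I, w, hw, hwu⟩ := isOpen_pi_iff.1 hu _ hHu
    refine ⟨I, I.finite_toSet, fun L hL => hts (hut (hwu fun i hi => ?_))⟩
    have h1 : decide (i ∈ L) = decide (i ∈ H) := by simp [hL i hi]
    show decide (i ∈ L) ∈ w i
    rw [h1]
    exact (hw i hi).2
  · rintro ⟨F, hF, hs⟩
    refine Filter.mem_of_superset ?_ hs
    have h1 : {L : Subgroup Γ | ∀ g ∈ F, g ∈ L ↔ g ∈ H} =
        ⋂ g ∈ F, {L : Subgroup Γ | g ∈ L ↔ g ∈ H} := by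
      ext
      simp
    rw [h1, Filter.biInter_mem hF]
    intro g _
    refine (mem_nhds_induced _ H _).2 ⟨{x | x g = decide (g ∈ H)}, ?_, fun L hL => ?_⟩
    · refine IsOpen.mem_nhds ?_ rfl
      exact (isOpen_discrete ({decide (g ∈ H)} : Set Bool)).preimage
        (continuous_apply (A := fun _ : Γ => Bool) g)
    · have h2 : decide (g ∈ L) = decide (g ∈ H) := hL
      simpa using h2

theorem mem_derivedSet_subgroup {H : Subgroup Γ} {C : Set (Subgroup Γ)} :
    H ∈ derivedSet C ↔
      ∀ F : Set Γ, F.Finite → ∃ L ∈ C, L ≠ H ∧ ∀ g ∈ F, g ∈ L ↔ g ∈ H := by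
  rw [mem_derivedSet, accPt_iff_nhds]
  constructor
  · intro h F hF
    obtain ⟨L, ⟨hL1, hL2⟩, hne⟩ := h _ (mem_nhds_subgroup.2 ⟨F, hF, subset_rfl⟩)
    exact ⟨L, hL2, hne, hL1⟩
  · intro h U hU
    obtain ⟨F, hF, hFU⟩ := mem_nhds_subgroup.1 hU
    obtain ⟨L, hL, hne, hLF⟩ := h F hF
    exact ⟨L, ⟨hFU hLF, hL⟩, hne⟩

theorem mem_derivedSet_of_map_subtype {G : Subgroup Γ} {H : Subgroup G} {C : Set (Subgroup G)}
    (h : ∀ F : Set Γ, F.Finite → ∃ L ≤ G, L.subgroupOf G ∈ C ∧ L ≠ H.map G.subtype ∧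
      ∀ g ∈ F, g ∈ L ↔ g ∈ H.map G.subtype) : H ∈ derivedSet C := by
  refine mem_derivedSet_subgroup.2 fun F hF => ?_
  obtain ⟨L, hLG, hLC, hne, hLF⟩ := h (Set.image G.subtype F) (hF.image _)
  refine ⟨L.subgroupOf G, hLC, ?_, fun g hg => ?_⟩
  · rintro rfl
    exact hne (Subgroup.map_subgroupOf_eq_of_le hLG).symm
  · rw [Subgroup.mem_subgroupOf]
    refine (hLF g ⟨g, hg, rfl⟩).trans ?_
    exact Subgroup.mem_map_iff_mem G.subtype_injective

/-- A decreasing sequence of subgroups converges to its intersection. -/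
theorem exists_mem_iff_of_antitone {H : Subgroup Γ} {L : ℕ → Subgroup Γ} (hanti : Antitone L)
    (hle : ∀ j, H ≤ L j) (hinf : ∀ g, (∀ j, g ∈ L j) → g ∈ H) {F : Set Γ} (hF : F.Finite) :
    ∃ j, ∀ g ∈ F, g ∈ L j ↔ g ∈ H := by
  have h1 : ∀ g, ∃ j, g ∈ L j → g ∈ H := fun g => by
    by_contra! h
    exact (h 0).2 (hinf g fun j => (h j).1)
  choose j hj using h1
  obtain ⟨J, hJ⟩ := (hF.image j).bddAbove
  exact ⟨J, fun g hg => ⟨fun h => hj g (hanti (hJ ⟨g, hg, rfl⟩) h), fun h => hle J h⟩⟩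

theorem Subgroup.exists_mul_of_mem_sup {H C : Subgroup Γ} (hn : ∀ h ∈ H, ∀ c ∈ C, h * c * h⁻¹ ∈ C)
    {g : Γ} (hg : g ∈ H ⊔ C) : ∃ h ∈ H, ∃ c ∈ C, h * c = g := by
  let K : Subgroup Γ :=
    { carrier := {g | ∃ h ∈ H, ∃ c ∈ C, h * c = g}
      one_mem' := ⟨1, one_mem _, 1, one_mem _, mul_one 1⟩
      mul_mem' := by
        rintro _ _ ⟨h, hh, c, hc, rfl⟩ ⟨h', hh', c', hc', rfl⟩
        refine ⟨h * h', mul_mem hh hh', h'⁻¹ * c * h'⁻¹⁻¹ * c',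
          mul_mem (hn _ (inv_mem hh') _ hc) hc', ?_⟩
        group
      inv_mem' := by
        rintro _ ⟨h, hh, c, hc, rfl⟩
        refine ⟨h⁻¹, inv_mem hh, h * c⁻¹ * h⁻¹, hn _ hh _ (inv_mem hc), ?_⟩
        group }
  have h1 : H ⊔ C ≤ K := sup_le (fun h hh => ⟨h, hh, 1, one_mem _, mul_one h⟩)
    fun c hc => ⟨1, one_mem _, c, hc, one_mul c⟩
  exact h1 hg

end SubgroupSpace

namespace RootedTree

variable {d : ℕ} {G : Subgroup (TreeAut d)}

/-! ### Subgroup induction -/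

theorem finite_secSubgroup (v : List (Fin d)) {H : Subgroup (TreeAut d)} (h : Finite H) :
    Finite (secSubgroup v H) := by
  have hr : ((H : Set (TreeAut d)).Finite) := h
  refine Set.Finite.subset (hr.image (sec v)) fun x hx => ?_
  obtain ⟨g, hg, -, rfl⟩ := mem_secSubgroup.1 hx
  exact ⟨g, hg, rfl⟩

theorem exists_inf_levelStab_eq_bot [Nonempty (Fin d)] {Q : Subgroup (TreeAut d)} (hQ : Finite Q) :
    ∃ k : ℕ, ∀ q ∈ Q, q ∈ levelStab d k → q = 1 := by
  have hr : ((Q : Set (TreeAut d)).Finite) := hQ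
  have h1 : ∀ q : TreeAut d, ∃ k, q ∈ levelStab d k → q = 1 := fun q => by
    by_contra! h
    obtain ⟨n, hn⟩ := exists_notMem_levelStab (h 0).2
    exact hn (h n).1
  choose k hk using h1
  obtain ⟨K, hK⟩ := (hr.image k).bddAbove
  exact ⟨K, fun q hq h => hk q (levelStab_antitone (hK ⟨q, hq, rfl⟩) h)⟩

theorem finite_of_relIndex_ne_zero {Γ : Type*} [Group Γ] {H L : Subgroup Γ} (hH : Finite H)
    (h : H.relIndex L ≠ 0) : Finite L := by
  refine Nat.finite_of_card_ne_zero ?_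
  rw [← Subgroup.relIndex_bot_left]
  refine Subgroup.relIndex_ne_zero_trans ?_ h
  rw [Subgroup.relIndex_bot_left]
  exact Nat.card_pos.ne'

/-- The subgroups whose sections on level `n` are all finite or of finite index in `G`. -/
def finiteOrFiniteIndex (G : Subgroup (TreeAut d)) (n : ℕ) : Set (Subgroup (TreeAut d)) :=
  {H | ∀ v : List (Fin d), v.length = n →
    Finite (secSubgroup v H) ∨ (secSubgroup v H).relIndex G ≠ 0}

namespace IsCongruenceBranch

theorem finiteOrFiniteIndex_mono (hG : IsCongruenceBranch G) {n k : ℕ} (hnk : n ≤ k)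
    {H : Subgroup (TreeAut d)} (h : H ∈ finiteOrFiniteIndex G n) : H ∈ finiteOrFiniteIndex G k := by
  intro v hv
  rw [← List.take_append_drop n v, secSubgroup_append]
  exact (h (v.take n) (by simpa [hv] using hnk)).imp (finite_secSubgroup _)
    (hG.secSubgroup_relIndex_self _)

/-- The subgroups of `G` whose sections on some level are all finite or of finite index form an
inductive class. -/
theorem isInductiveClass (hG : IsCongruenceBranch G) :
    IsInductiveClass G {H | H ≤ G ∧ ∃ n, H ∈ finiteOrFiniteIndex G n} where
  le_of_mem H hH := hH.1
  bot_mem := ⟨bot_le, 0, fun v _ => Or.inl (finite_secSubgroup v inferInstance)⟩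
  self_mem := ⟨le_rfl, 0, fun v _ =>
    Or.inr (by rw [hG.secSubgroup_self, Subgroup.relIndex_self]; simp)⟩
  mem_iff_of_finite_index H L hHL hL hi := by
    constructor
    · rintro ⟨-, n, hn⟩
      refine ⟨hHL.trans hL, n, fun v hv => (hn v hv).imp (fun h => ?_) fun h => ?_⟩
      · have h1 : ((secSubgroup v L : Set (TreeAut d)).Finite) := h
        exact h1.subset (secSubgroup_mono v hHL)
      · exact Subgroup.relIndex_ne_zero_trans (secSubgroup_relIndex_ne_zero v hi) h
    · rintro ⟨-, n, hn⟩
      exact ⟨hL, n, fun v hv => (hn v hv).imp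
        (fun h => finite_of_relIndex_ne_zero h (secSubgroup_relIndex_ne_zero v hi))
        (Subgroup.relIndex_ne_zero_of_le_left (secSubgroup_mono v hHL))⟩
  mem_of_sections H _ hH h := by
    choose hle n hn using h
    refine ⟨fun g hg => (hH hg).1, 1 + Finset.univ.sup n, fun v hv => ?_⟩
    obtain ⟨x, u, rfl⟩ := List.exists_cons_of_length_pos (l := v) (by omega)
    rw [← List.singleton_append, secSubgroup_append]
    exact hG.finiteOrFiniteIndex_mono (Finset.le_sup (Finset.mem_univ x)) (hn x) u
      (by simp at hv; omega)

theorem isFull_or_exists_finite (hG : IsCongruenceBranch G) (hsip : HasSubgroupInductionProperty G)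
    {H : Subgroup (TreeAut d)} (hH : H ≤ G) (hfg : H.FG) :
    IsFull G H ∨ ∃ v : List (Fin d), Finite (secSubgroup v H) := by
  obtain ⟨-, n, hn⟩ := hsip _ hG.isInductiveClass H hH hfg
  by_cases h : ∃ v : List (Fin d), Finite (secSubgroup v H)
  · exact Or.inr h
  · exact Or.inl ⟨hH, n, fun v hv => (hn v hv).resolve_left fun hf => h ⟨v, hf⟩⟩

/-- A section that is both finite and of finite index would make `G` finite. -/
theorem not_finite_of_isFull [Nontrivial (Fin d)] (hG : IsCongruenceBranch G)
    {H : Subgroup (TreeAut d)} (hH : IsFull G H) (v : List (Fin d)) :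
    ¬ Finite (secSubgroup v H) := by
  intro hf
  obtain ⟨hle, n, hn⟩ := hH
  have key : ∃ u : List (Fin d), Finite (secSubgroup u H) ∧ (secSubgroup u H).relIndex G ≠ 0 := by
    rcases le_total n v.length with h | h
    · refine ⟨v, hf, ?_⟩
      rw [← List.take_append_drop n v, secSubgroup_append]
      exact hG.secSubgroup_relIndex_self _ (hn _ (by simpa using h))
    · obtain ⟨x⟩ : Nonempty (Fin d) := inferInstance
      refine ⟨v ++ List.replicate (n - v.length) x, ?_, hn _ (by simp; omega)⟩
      rw [secSubgroup_append]
      exact finite_secSubgroup _ hf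
  obtain ⟨u, hu1, hu2⟩ := key
  obtain ⟨k, hk⟩ := exists_inf_levelStab_eq_bot (finite_of_relIndex_ne_zero hu1 hu2)
  obtain ⟨g, hg, hg1⟩ := hG.exists_ne_one k
  exact hg1 (hk g hg.1 hg.2)

/-! ### Subgroups with a finite section are not isolated among themselves -/

theorem exists_notMem_orbit [Nontrivial (Fin d)] {H : Subgroup (TreeAut d)} {v : List (Fin d)}
    (hf : Finite (secSubgroup v H)) : ∃ w w' : List (Fin d), w.length = w'.length ∧
      (∀ h ∈ H, h w ≠ w') ∧ Finite (secSubgroup w H) ∧ Finite (secSubgroup w' H) := by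
  -- A group of order `i` cannot act transitively on the `d ^ i > i` words of length `i`.
  set i := Nat.card (secSubgroup v H) with hi
  obtain ⟨x⟩ : Nonempty (Fin d) := inferInstance
  by_contra! hcon
  have h1 : ∀ u : List.Vector (Fin d) i, ∃ q : secSubgroup v H,
      (q : TreeAut d) (List.replicate i x) = u.1 := fun u => by
    by_contra! h
    refine (hcon (v ++ List.replicate i x) (v ++ u.1) (by simp [u.2]) (fun g hg hgu => ?_)
      (by rw [secSubgroup_append]; exact finite_secSubgroup _ hf)).not_finite
      (by rw [secSubgroup_append]; exact finite_secSubgroup _ hf)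
    rw [apply_append_sec] at hgu
    obtain ⟨h2, h3⟩ := List.append_inj hgu (length_apply g v)
    exact h ⟨sec v g, mem_secSubgroup.2 ⟨g, hg, h2, rfl⟩⟩ h3
  choose q hq using h1
  have hinj : Function.Injective q := fun a b hab => Subtype.ext (by rw [← hq a, ← hq b, hab])
  have h2 := Nat.card_le_card_of_injective q hinj
  have h3 : Nat.card (List.Vector (Fin d) i) = d ^ i := by
    rw [Nat.card_eq_fintype_card, card_vector, Fintype.card_fin]
  rw [h3, ← hi] at h2
  have hd : 2 ≤ d := Fin.nontrivial_iff_two_le.1 inferInstance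
  exact absurd (Nat.lt_pow_self (n := i) (a := d) (by omega)) (by omega)

/-- The approximating groups are `H ⊔ C j`, where `C j` consists of deep elements of `G` supported
below the `H`-orbit of `w`. The vertex `w'` outside the orbit keeps its finite section. -/
theorem exists_ne_of_finite [Nontrivial (Fin d)] (hG : IsCongruenceBranch G)
    {H : Subgroup (TreeAut d)} (hH : H ≤ G) {v : List (Fin d)} (hf : Finite (secSubgroup v H))
    {F : Set (TreeAut d)} (hF : F.Finite) :
    ∃ L ≤ G, (∃ w : List (Fin d), Finite (secSubgroup w L)) ∧ L ≠ H ∧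
      ∀ g ∈ F, g ∈ L ↔ g ∈ H := by
  obtain ⟨w, w', hww, horb, hw, hw'⟩ := exists_notMem_orbit hf
  set E : Set (List (Fin d)) := {u | u.length = w.length ∧ ∀ h ∈ H, h w ≠ u} with hE
  let C : ℕ → Subgroup (TreeAut d) := fun j => G ⊓ levelStab d (w.length + j) ⊓ fixBelow E
  have hCN : ∀ j, C j ≤ levelStab d w.length := fun j g hg =>
    levelStab_antitone (Nat.le_add_right _ _) hg.1.2
  have hCanti : Antitone C := fun i j hij =>
    inf_le_inf (inf_le_inf le_rfl (levelStab_antitone (Nat.add_le_add_left hij _))) le_rfl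
  have hCn : ∀ j, ∀ h ∈ H, ∀ c ∈ C j, h * c * h⁻¹ ∈ C j := by
    intro j h hh c hc
    have h1 := (levelStab_normal _).conj_mem _ hc.1.2 h
    refine ⟨⟨G.mul_mem (G.mul_mem (hH hh) hc.1.1) (G.inv_mem (hH hh)), h1⟩,
      mem_fixBelow.2 fun u hu => ⟨fixed_of_mem_levelStab h1 (by rw [hu.1]; omega), ?_⟩⟩
    have h2 : h⁻¹ u ∈ E := by
      refine ⟨(length_apply _ _).trans hu.1, fun g hg hgw => hu.2 (h * g) (mul_mem hh hg) ?_⟩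
      rw [RelIso.mul_apply, hgw, apply_inv_apply]
    have h3 := mem_fixBelow.1 hc.2 _ h2
    have h4 := sec_conj h h3.1
    rw [apply_inv_apply, h3.2] at h4
    simpa using h4
  obtain ⟨k, hk⟩ := exists_inf_levelStab_eq_bot hw
  -- Conjugated to `w`, the section of such an element lies in a finite group and deep in the tree,
  -- so it is trivial.
  have hCk : ∀ c ∈ C k, c ∈ H → c = 1 := by
    intro c hc hcH
    refine eq_one_of_sec_eq_one (hCN k hc) fun u hu => ?_
    by_cases huE : u ∈ E
    · exact (mem_fixBelow.1 hc.2 u huE).2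
    · obtain ⟨h, hh, rfl⟩ : ∃ h ∈ H, h w = u := by
        by_contra! h
        exact huE ⟨hu, h⟩
      have h1 := hCn k h⁻¹ (inv_mem hh) c hc
      have h2 := hk (sec w (h⁻¹ * c * h⁻¹⁻¹)) (mem_secSubgroup.2 ⟨_, H.mul_mem
        (H.mul_mem (H.inv_mem hh) hcH) (H.inv_mem (H.inv_mem hh)),
        mem_levelStab.1 (hCN k h1) w rfl, rfl⟩) ((mem_levelStab_add.1 h1.1.2).2 w rfl)
      have h3 := sec_conj h⁻¹ (mem_levelStab.1 (hCN k hc) _ hu)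
      rw [inv_apply_apply, h2] at h3
      have h4 := h3.symm
      rwa [mul_inv_eq_one, mul_eq_left] at h4
  obtain ⟨j, hj⟩ := exists_mem_iff_of_antitone (H := H) (L := fun j => H ⊔ C j)
    (fun i j hij => sup_le_sup_left (hCanti hij) H) (fun j => le_sup_left) (fun g hg => by
      obtain ⟨h, hh, c, hc, rfl⟩ := Subgroup.exists_mul_of_mem_sup (hCn k) (hg k)
      have hc1 : c = 1 := by
        by_contra hne
        obtain ⟨i, hi⟩ := exists_notMem_levelStab hne
        obtain ⟨h', hh', c', hc', heq⟩ :=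
          Subgroup.exists_mul_of_mem_sup (hCn (max i k)) (hg (max i k))
        -- Two factorizations of one element differ by an element of `H` and `C k`, so `c = c'` lies
        -- arbitrarily deep.
        have h5 : c' * c⁻¹ = h'⁻¹ * h := by
          rw [mul_inv_eq_iff_eq_mul, mul_assoc, ← heq, inv_mul_cancel_left]
        have h6 := hCk (c' * c⁻¹) (mul_mem (hCanti (le_max_right i k) hc') (inv_mem hc))
          (h5 ▸ mul_mem (inv_mem hh') hh)
        rw [mul_inv_eq_one] at h6
        subst h6
        exact hi (levelStab_antitone (by omega) hc'.1.2)
      rw [hc1, mul_one]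
      exact hh) hF
  refine ⟨H ⊔ C j, sup_le hH (inf_le_left.trans inf_le_left), ⟨w', ?_⟩, fun heq => ?_, hj⟩
  · have hr : ((secSubgroup w' H : Set (TreeAut d)).Finite) := hw'
    refine hr.subset fun x hx => ?_
    obtain ⟨g, hg, hgw, rfl⟩ := mem_secSubgroup.1 hx
    obtain ⟨h, hh, c, hc, rfl⟩ := Subgroup.exists_mul_of_mem_sup (hCn j) hg
    have h1 := mem_fixBelow.1 hc.2 w' ⟨hww.symm, horb⟩
    rw [sec_mul_of_fixed _ h1.1, h1.2, mul_one]
    rw [RelIso.mul_apply, h1.1] at hgw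
    exact mem_secSubgroup.2 ⟨h, hh, hgw, rfl⟩
  · obtain ⟨m, hm⟩ := hG.exists_delta
    obtain ⟨s, hs, hs1⟩ := hG.exists_ne_one (max m (max j k))
    have hsm := levelStab_antitone (le_max_left m (max j k)) hs.2
    have hsj := levelStab_antitone ((le_max_left j k).trans (le_max_right m _)) hs.2
    have hsk := levelStab_antitone ((le_max_right j k).trans (le_max_right m _)) hs.2
    have hd : delta w s ∈ C j := by
      refine ⟨⟨hm w s ⟨hs.1, hsm⟩, delta_mem_levelStab_add w hsj⟩, mem_fixBelow.2 fun u hu =>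
        ⟨mem_levelStab.1 (delta_mem_levelStab w s) u hu.1, sec_delta_of_ne s hu.1 ?_⟩⟩
      rintro rfl
      exact hu.2 1 (one_mem _) rfl
    have hdH : delta w s ∈ H := heq ▸ (le_sup_right : C j ≤ _) hd
    exact hs1 (hk s (mem_secSubgroup.2 ⟨_, hdH, mem_levelStab.1 (delta_mem_levelStab w s) w rfl,
      sec_delta_self w s⟩) hsk)

/-- The subgroups of `G` that are not full form a set without isolated points. -/
theorem preperfect_not_isFull [Nontrivial (Fin d)] (hG : IsCongruenceBranch G)
    (hsip : HasSubgroupInductionProperty G) :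
    Preperfect {H : Subgroup G | ¬ IsFull G (H.map G.subtype)} := by
  refine preperfect_iff_subset_derivedSet.2 fun H hH => ?_
  set H' := H.map G.subtype with hH'
  have hle : H' ≤ G := Subgroup.map_subtype_le H
  refine mem_derivedSet_of_map_subtype fun F hF => ?_
  by_cases hfg : H'.FG
  · obtain ⟨v, hv⟩ := (hG.isFull_or_exists_finite hsip hle hfg).resolve_left hH
    obtain ⟨L, hL, ⟨w, hw⟩, hne, hLF⟩ := hG.exists_ne_of_finite hle hv hF
    refine ⟨L, hL, fun hfull => ?_, hne, hLF⟩
    rw [Subgroup.map_subgroupOf_eq_of_le hL] at hfull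
    exact hG.not_finite_of_isFull hfull w hw
  -- If this finitely generated approximation were full, so would be `H'`, which would then be
  -- finitely generated.
  · set L := Subgroup.closure (F ∩ H') with hL
    have hLH : L ≤ H' := (Subgroup.closure_le _).2 Set.inter_subset_right
    refine ⟨L, hLH.trans hle, fun hfull => ?_, ?_, fun g hg => ⟨fun h => hLH h, fun h =>
      Subgroup.subset_closure ⟨hg, h⟩⟩⟩
    · rw [Subgroup.map_subgroupOf_eq_of_le (hLH.trans hle)] at hfull
      exact hfg (hG.fg_of_isFull (hfull.mono hLH hle))
    · intro heq
      rw [← hH'] at heq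
      exact hfg (heq ▸ (Subgroup.fg_iff _).2 ⟨_, rfl, hF.inter_of_left _⟩)

/-! ### Full subgroups have finite rank -/

/-- The number of pairs of a vertex of level `n` and a vertex of level `N` determined by it. -/
noncomputable def linkCount (L : Subgroup (TreeAut d)) (n N : ℕ) : ℕ :=
  ∑ v ∈ (finite_level d n).toFinset, (determined L N v).ncard

theorem determined_finite (L : Subgroup (TreeAut d)) (N : ℕ) (v : List (Fin d)) :
    (determined L N v).Finite := (finite_level d N).subset fun _ hw => hw.1

/-- `F` contains generators of `L`, which force `L ≤ L'`, and a transversal of `L ⊓ levelStab d J`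
in its normalizer. If no link is lost, this intersection is the same for `L'`, so `L'` lies in that
normalizer and the transversal forces `L' = L`. -/
theorem exists_finite_linkCount_lt [Nontrivial (Fin d)] (hG : IsCongruenceBranch G)
    {H L : Subgroup (TreeAut d)} {n N : ℕ} (hb : IsBase G H n N) (hHL : H ≤ L) (hL : L ≤ G) :
    ∃ F : Set (TreeAut d), F.Finite ∧ ∀ L' ≤ G, (∀ g ∈ F, g ∈ L' ↔ g ∈ L) → L' ≠ L →
      L ≤ L' ∧ linkCount L' n N < linkCount L n N := by
  have hfull : IsFull G L := IsFull.mono ⟨hb.le, n, hb.relIndex_ne_zero⟩ hHL hL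
  obtain ⟨S, hS, hSf⟩ := (Subgroup.fg_iff L).1 (hG.fg_of_isFull hfull)
  obtain ⟨J, hJ⟩ := hG.exists_inf_levelStab_le hb hHL hL
  have hM := hfull.of_relIndex_ne_zero inf_le_left (inf_levelStab_relIndex_ne_zero J L)
  obtain ⟨T, hTf, -, hT⟩ := Subgroup.exists_finite_transversal (hG.relIndex_normalizer_ne_zero hM)
  refine ⟨S ∪ T, hSf.union hTf, fun L' hL' hF hne => ?_⟩
  have hLL' : L ≤ L' := by
    rw [← hS, Subgroup.closure_le]
    exact fun g hg => (hF g (Or.inl hg)).2 (hS ▸ Subgroup.subset_closure hg)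
  refine ⟨hLL', ?_⟩
  have hle : ∀ v ∈ (finite_level d n).toFinset,
      (determined L' N v).ncard ≤ (determined L N v).ncard := fun v _ =>
    Set.ncard_le_ncard (determined_anti hLL' N v) (determined_finite L N v)
  refine lt_of_le_of_ne (Finset.sum_le_sum hle) fun heq => hne ?_
  have heq' := (Finset.sum_eq_sum_iff_of_le hle).1 heq
  have hinf : L' ⊓ levelStab d J ≤ L := by
    refine hJ L' hL' hLL' (fun v hv => ?_) L fun v _ => freePart_le L N v
    refine (Set.eq_of_subset_of_ncard_le (determined_anti hLL' N v) ?_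
      (determined_finite L N v)).ge
    exact (heq' v (by simpa using hv)).ge
  have hinf' : L' ⊓ levelStab d J = L ⊓ levelStab d J :=
    le_antisymm (le_inf hinf inf_le_right) (inf_le_inf_right _ hLL')
  have hnorm : L' ≤ Subgroup.normalizer ((L ⊓ levelStab d J : Subgroup _) : Set (TreeAut d)) := by
    rw [← hinf']
    intro g hg
    have key : ∀ g ∈ L', ∀ x ∈ L' ⊓ levelStab d J, g * x * g⁻¹ ∈ L' ⊓ levelStab d J :=
      fun g hg x hx => ⟨L'.mul_mem (L'.mul_mem hg hx.1) (L'.inv_mem hg),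
        (levelStab_normal J).conj_mem _ hx.2 g⟩
    refine Subgroup.mem_normalizer_iff.2 fun x => ⟨key g hg x, fun hx => ?_⟩
    have := key g⁻¹ (inv_mem hg) _ hx
    simpa [mul_assoc] using this
  refine le_antisymm (fun g hg => ?_) hLL'
  obtain ⟨t, ht, htg⟩ := hT g ⟨hL' hg, hnorm hg⟩
  have htL' : t ∈ L' := by
    have := L'.mul_mem hg (L'.inv_mem (hLL' htg.1))
    simpa using this
  have htL := (hF t (Or.inr ht)).1 htL'
  simpa using L.mul_mem htL htg.1

-- The levels `n` and `N` are chosen once for `H` and serve all its overgroups, so each derivative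
-- lowers the same count.
open CantorBendixson in
theorem exists_notMem_iteratedDerivedSet [Nontrivial (Fin d)] (hG : IsCongruenceBranch G)
    {H : Subgroup G} (hH : IsFull G (H.map G.subtype)) :
    ∃ r : ℕ, H ∉ iteratedDerivedSet (Set.univ : Set (Subgroup G)) (r : Ordinal.{0}) := by
  obtain ⟨n, N, hb⟩ := hG.exists_isBase hH
  have key : ∀ (r : ℕ) (L : Subgroup G), H.map G.subtype ≤ L.map G.subtype →
      linkCount (L.map G.subtype) n N < r →
      L ∉ iteratedDerivedSet (Set.univ : Set (Subgroup G)) (r : Ordinal.{0}) := by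
    intro r
    induction r with
    | zero => exact fun L _ h => absurd h (Nat.not_lt_zero _)
    | succ r ih =>
      intro L hHL hr hmem
      rw [Nat.cast_succ, iteratedDerivedSet_succ] at hmem
      obtain ⟨F, hF, hFL⟩ := hG.exists_finite_linkCount_lt hb hHL (Subgroup.map_subtype_le L)
      obtain ⟨L', hL', hne, hLF⟩ := mem_derivedSet_subgroup.1 hmem.1 (Set.preimage G.subtype F)
        (hF.preimage G.subtype_injective.injOn)
      obtain ⟨h1, h2⟩ := hFL (L'.map G.subtype) (Subgroup.map_subtype_le L') (fun g hg => by
        by_cases hgG : g ∈ G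
        · have h3 := hLF ⟨g, hgG⟩ hg
          rw [← Subgroup.mem_map_iff_mem G.subtype_injective,
            ← Subgroup.mem_map_iff_mem G.subtype_injective] at h3
          exact h3
        · exact ⟨fun h => absurd (Subgroup.map_subtype_le L' h) hgG,
            fun h => absurd (Subgroup.map_subtype_le L h) hgG⟩)
        (fun h => hne (Subgroup.map_injective G.subtype_injective h))
      exact ih L' (hHL.trans h1) (by omega) hL'
  exact ⟨_, key _ H le_rfl (Nat.lt_succ_self _)⟩

/-! ### Full subgroups of large rank -/

/-- The subgroup of the elements `g` of `G` fixing level `N + m` for which the sections at the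
vertices `v` of level `N` agree with the section at `b` up to level `J v`. -/
def linked (G : Subgroup (TreeAut d)) [Nonempty (Fin d)] (N m : ℕ) (b : List (Fin d))
    (hb : b.length = N) (J : List (Fin d) → ℕ∞) : Subgroup (TreeAut d) where
  carrier := {g | g ∈ G ⊓ levelStab d (N + m) ∧ ∀ v : List (Fin d), v.length = N → ∀ k : ℕ,
    (k : ℕ∞) ≤ J v → QuotientGroup.mk' (levelStab d k) (sec v g) =
      QuotientGroup.mk' (levelStab d k) (sec b g)}
  one_mem' := ⟨one_mem _, fun v _ k _ => by simp only [sec_one]⟩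
  mul_mem' {g h} hg hh := ⟨mul_mem hg.1 hh.1, fun v hv k hk => by
    have hN := levelStab_antitone (Nat.le_add_right N m) hh.1.2
    rw [sec_mul_of_fixed _ (mem_levelStab.1 hN v hv), sec_mul_of_fixed _ (mem_levelStab.1 hN b hb),
      map_mul, map_mul, hg.2 v hv k hk, hh.2 v hv k hk]⟩
  inv_mem' {g} hg := ⟨inv_mem hg.1, fun v hv k hk => by
    have hN := levelStab_antitone (Nat.le_add_right N m) hg.1.2
    rw [sec_inv_of_fixed (mem_levelStab.1 hN v hv), sec_inv_of_fixed (mem_levelStab.1 hN b hb),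
      map_inv, map_inv, hg.2 v hv k hk]⟩

theorem linked_le [Nonempty (Fin d)] {N m : ℕ} {b : List (Fin d)}
    {hb : b.length = N} {J : List (Fin d) → ℕ∞} : linked G N m b hb J ≤ G := fun _ hg => hg.1.1

theorem linked_anti [Nonempty (Fin d)] {N m : ℕ} {b : List (Fin d)}
    {hb : b.length = N} {J J' : List (Fin d) → ℕ∞} (h : J ≤ J') :
    linked G N m b hb J' ≤ linked G N m b hb J := fun _ hg =>
  ⟨hg.1, fun v hv k hk => hg.2 v hv k (hk.trans (h v))⟩

/-- Repeating one section at every vertex satisfies all the links. -/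
theorem isFull_linked [Nonempty (Fin d)] {N m : ℕ}
    (hm : ∀ (n : ℕ) (f : List (Fin d) → TreeAut d), (∀ v, f v ∈ G ⊓ levelStab d m) → glue n f ∈ G)
    {b : List (Fin d)} (hb : b.length = N) (J : List (Fin d) → ℕ∞) :
    IsFull G (linked G N m b hb J) := by
  refine ⟨linked_le, N, fun v hv => Subgroup.relIndex_ne_zero_of_le_left (fun s hs => ?_)
    (inf_levelStab_relIndex_ne_zero m G)⟩
  refine mem_secSubgroup.2 ⟨glue N fun _ => s, ⟨⟨hm N _ fun _ => hs, mem_levelStab_add.2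
    ⟨glue_mem_levelStab N _, fun u hu => ?_⟩⟩, fun u hu k _ => ?_⟩,
    mem_levelStab.1 (glue_mem_levelStab N _) v hv, sec_glue _ hv⟩
  · rw [sec_glue _ hu]
    exact hs.2
  · rw [sec_glue _ hu, sec_glue _ hb]

-- Weakening the equality at `a` to agreement up to depth `j` gives subgroups converging to the
-- original as `j` grows; the links at the rest of `A` remain exact, so induction applies to them.
open CantorBendixson in
theorem linked_mem_iteratedDerivedSet [Nontrivial (Fin d)] (hG : IsCongruenceBranch G) {N m : ℕ}
    (hm : ∀ (n : ℕ) (f : List (Fin d) → TreeAut d), (∀ v, f v ∈ G ⊓ levelStab d m) → glue n f ∈ G)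
    {b : List (Fin d)} (hb : b.length = N) (A : Finset (List (Fin d)))
    (hA : ∀ v ∈ A, v.length = N ∧ v ≠ b) (J : List (Fin d) → ℕ∞) (hJ : ∀ v ∈ A, J v = ⊤) :
    (linked G N m b hb J).subgroupOf G ∈
      iteratedDerivedSet (Set.univ : Set (Subgroup G)) ((A.card : ℕ) : Ordinal.{0}) := by
  classical
  induction A using Finset.induction_on generalizing J with
  | empty => simp
  | insert a A haA ih =>
    have hA' : ∀ v ∈ A, v.length = N ∧ v ≠ b := fun v hv => hA v (Finset.mem_insert_of_mem hv)
    obtain ⟨haN, hab⟩ := hA a (Finset.mem_insert_self _ _)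
    have hJa := hJ a (Finset.mem_insert_self _ _)
    rw [Finset.card_insert_of_notMem haA, Nat.cast_succ, iteratedDerivedSet_succ]
    refine ⟨mem_derivedSet_of_map_subtype fun F hF => ?_,
      ih hA' J fun v hv => hJ v (Finset.mem_insert_of_mem hv)⟩
    rw [Subgroup.map_subgroupOf_eq_of_le linked_le]
    obtain ⟨j, hj⟩ := exists_mem_iff_of_antitone (H := linked G N m b hb J)
      (L := fun j : ℕ => linked G N m b hb (Function.update J a j))
      (fun i j hij => linked_anti (update_le_update_iff.2
        ⟨by exact_mod_cast hij, fun _ _ => le_rfl⟩))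
      (fun j => linked_anti (update_le_iff.2 ⟨by rw [hJa]; exact le_top,
        fun _ _ => le_rfl⟩))
      (fun g hg => ⟨(hg 0).1, fun v hv k hk => (hg k).2 v hv k (by
        by_cases hva : v = a
        · rw [hva, Function.update_self]
        · rwa [Function.update_of_ne hva])⟩) hF
    refine ⟨_, linked_le, ih hA' (Function.update J a j) fun v hv => ?_, fun heq => ?_, hj⟩
    · rw [Function.update_of_ne (by rintro rfl; exact haA hv)]
      exact hJ v (Finset.mem_insert_of_mem hv)
    -- An element supported below `a` and deeper than `j` satisfies the weakened link but not the
    -- exact one.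
    · obtain ⟨s, hs, hs1⟩ := hG.exists_ne_one (max m j)
      have hsm := levelStab_antitone (le_max_left m j) hs.2
      have hba : b ≠ a := hab.symm
      have hd : delta a s ∈ linked G N m b hb (Function.update J a j) := by
        refine ⟨⟨?_, haN ▸ delta_mem_levelStab_add a hsm⟩, fun v hv k hk => ?_⟩
        · refine hm _ _ fun u => ?_
          split_ifs
          · exact ⟨hs.1, hsm⟩
          · exact one_mem _
        · rw [sec_delta_of_ne s (hb.trans haN.symm) hba]
          by_cases hva : v = a
          · subst hva
            rw [Function.update_self, Nat.cast_le] at hk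
            rw [sec_delta_self, map_one]
            exact (QuotientGroup.eq_one_iff s).2
              (levelStab_antitone (hk.trans (le_max_right m j)) hs.2)
          · rw [sec_delta_of_ne s (hv.trans haN.symm) hva]
      rw [heq] at hd
      obtain ⟨k, hk⟩ := exists_notMem_levelStab hs1
      refine hk ((QuotientGroup.eq_one_iff s).1 ?_)
      have := hd.2 a haN k (by rw [hJa]; exact le_top)
      rwa [sec_delta_self, sec_delta_of_ne s (hb.trans haN.symm) hba, map_one] at this

open CantorBendixson in
theorem exists_isFull_mem_iteratedDerivedSet [Nontrivial (Fin d)] (hG : IsCongruenceBranch G)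
    (r : ℕ) : ∃ H : Subgroup G, IsFull G (H.map G.subtype) ∧
      H ∈ iteratedDerivedSet (Set.univ : Set (Subgroup G)) (r : Ordinal.{0}) := by
  classical
  obtain ⟨m, hm⟩ := hG.exists_glue
  obtain ⟨x⟩ : Nonempty (Fin d) := inferInstance
  set b := List.replicate r x with hbdef
  have hb : b.length = r := List.length_replicate
  set A := (finite_level d r).toFinset.erase b with hA
  -- Level `r` has `d ^ r > r` vertices, so at least `r` remain to be linked to `b`.
  have hcard : r ≤ A.card := by
    have h1 : (finite_level d r).toFinset.card = d ^ r := by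
      rw [← Set.ncard_eq_toFinset_card _ (finite_level d r), ← Nat.card_coe_set_eq]
      exact (Nat.card_eq_fintype_card (α := List.Vector (Fin d) r)).trans
        (by rw [card_vector, Fintype.card_fin])
    rw [hA, Finset.card_erase_of_mem (by simp [hb]), h1]
    have hd : 2 ≤ d := Fin.nontrivial_iff_two_le.1 inferInstance
    have := Nat.lt_pow_self (n := r) (a := d) (by omega)
    omega
  have h1 := hG.linked_mem_iteratedDerivedSet hm hb A (fun v hv => by
    rw [hA, Finset.mem_erase] at hv
    exact ⟨by simpa using hv.2, hv.1⟩) (fun _ => ⊤) fun _ _ => rfl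
  refine ⟨_, ?_, iteratedDerivedSet_antitone _ (by exact_mod_cast hcard) h1⟩
  rw [Subgroup.map_subgroupOf_eq_of_le linked_le]
  exact isFull_linked hm hb _

end IsCongruenceBranch

end RootedTree

/-! ### The Cantor–Bendixson rank. -/

open CantorBendixson

theorem mainTheorem6 (d : ℕ) (hd : 2 ≤ d) (G : Subgroup (RootedTree.TreeAut d))
    (hfg : G.FG)
    (hbranch : RootedTree.IsRegularBranch G)
    (hrep : RootedTree.IsStronglySelfReplicating G)
    (hstab : ∀ v ∈ RootedTree.level d 1,
      RootedTree.stab G {v} = RootedTree.stab G (RootedTree.level d 1))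
    (hcsp : RootedTree.HasCongruenceSubgroupProperty G)
    (hsip : RootedTree.HasSubgroupInductionProperty G) :
    cantorBendixsonRank (Subgroup G) = Ordinal.omega0 := by
  have : Nontrivial (Fin d) := Fin.nontrivial_iff_two_le.2 hd
  have hG := RootedTree.isCongruenceBranch hfg hbranch hrep hcsp
  set P : Set (Subgroup G) := {H | ¬ RootedTree.IsFull G (H.map G.subtype)} with hP
  have hpre : Preperfect P := hG.preperfect_not_isFull hsip
  have hPsub : ∀ α : Ordinal.{0}, P ⊆ iteratedDerivedSet (Set.univ : Set (Subgroup G)) α :=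
    fun α => by
      have h1 := iteratedDerivedSet_mono (Set.subset_univ P) α
      simpa only [iteratedDerivedSet_constant_iff_preperfect.1 hpre α] using h1
  refine le_antisymm (csInf_le' ?_) (le_csInf ⟨Ordinal.omega0, ?_⟩ ?_)
  -- The lower bound comes first; the two remaining goals coincide, as `ω` also witnesses
  -- nonemptiness.
  rotate_right
  · intro α hα
    by_contra! hlt
    obtain ⟨k, rfl⟩ := Ordinal.lt_omega0.1 hlt
    have hconst : ∀ r : ℕ,
        iteratedDerivedSet (Set.univ : Set (Subgroup G)) ((k + r : ℕ) : Ordinal.{0})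
        = iteratedDerivedSet (Set.univ : Set (Subgroup G)) (k : Ordinal.{0}) := by
      intro r
      induction r with
      | zero => simp
      | succ r ih =>
        rw [← add_assoc, Nat.cast_succ, iteratedDerivedSet_succ, ih, ← iteratedDerivedSet_succ]
        exact hα
    -- If the derivatives were constant from `k` on, a full subgroup surviving to stage `k` would
    -- never disappear.
    obtain ⟨H, hH, hHk⟩ := hG.exists_isFull_mem_iteratedDerivedSet k
    obtain ⟨r, hr⟩ := hG.exists_notMem_iteratedDerivedSet hH
    rw [← hconst r] at hHk
    exact hr (iteratedDerivedSet_antitone _ (by exact_mod_cast Nat.le_add_left r k) hHk)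
  all_goals
    refine subset_antisymm (iteratedDerivedSet_antitone _ le_self_add) ?_
    -- Every full subgroup is gone by stage `ω`, so only the perfect part `P` remains.
    refine subset_trans (fun H hH => ?_) (hPsub _)
    intro hfull
    obtain ⟨r, hr⟩ := hG.exists_notMem_iteratedDerivedSet hfull
    exact hr (iteratedDerivedSet_antitone _ (Ordinal.natCast_lt_omega0 r).le hH)
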